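/- **Proposition (Töplitz quantization for a classical Hamiltonian).** For $\hbar>0$ and $(q,p)\in\mathbb R^3\times\mathbb R^3$ let $$\varphi^\hbar_{(q,p)}(x)=\frac{1}{(\pi\hbar)^{3/4}}e^{-\frac{|x-q|^2}{2\hbar}}e^{\frac{ip\cdot x}{\hbar}},\qquad x\in\mathbb R^3,$$ and for a bounded measurable function $f:\mathbb R^6\to\mathbb R$ let $$\mathrm{Op}^T_\hbar[f]=\frac{1}{(2\pi\hbar)^3}\int_{\mathbb R^6}|\varphi^\hbar_{(q,p)}\rangle\langle\varphi^\hbar_{(q,p)}|\,f(q,p)\,dq\,dp$$ (a weak integral) be its Töplitz quantization, a bounded operator on $L^2(\mathbb R^3;\mathbb C)$. Let $\alpha:\mathbb R\to\mathbb R$ be a non-negative continuous function such that $\alpha(t)=0$ for all $t\le 0$. Let $\mu_\hbar\in\mathbb R$ satisfy $\mu_\hbar\to\mu>0$ as $\hbar\to0^+$, and let $(V_\hbar)_{\hbar\in(0,1]}$ be a family of real-valued functions on $\mathbb R^3$ with $$\sup_{\hbar\in(0,1]}\|V_\hbar\|_{C^{0,1/5}(\mathbb R^3)}<\infty,\qquad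 \|V\|_{C^{0,1/5}}=\sup_x|V(x)|+\sup_{x\ne y}\frac{|V(x)-V(y)|}{|x-y|^{1/5}}.$$ For every $\hbar\in(0,1]$ the operator $-\tfrac{\hbar^2}{2}\Delta+V_\hbar$ with domain $H^2(\mathbb R^3)$ is self-adjoint on $L^2(\mathbb R^3;\mathbb C)$, and both $\mathrm{Op}^T_\hbar\big[\alpha\big(-\mu_\hbar-(\tfrac{|p|^2}{2}+V_\hbar(q))\big)\big]$ and $\alpha\big(-\mu_\hbar-(-\tfrac{\hbar^2}{2}\Delta+V_\hbar)\big)$, the latter in the sense of the functional calculus, are well-defined bounded operators on $L^2(\mathbb R^3;\mathbb C)$. Moreover, in the operator norm, $$\lim_{\hbar\to0^+}\Big\|\mathrm{Op}^T_\hbar\Big[\alpha\big(-\mu_\hbar-(\tfrac{|p|^2}{2}+V_\hbar(q))\big)\Big]-\alpha\big(-\mu_\hbar-(-\tfrac{\hbar^2}{2}\Delta+V_\hbar)\big)\Big\|=0.$$ -/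

import Mathlib

open MeasureTheory Filter Topology Set
open scoped ENNReal NNReal SchwartzMap Laplacian

namespace Semiclassical

noncomputable section

/-- The position (or momentum) space `ℝ³`. -/
abbrev R3 : Type := EuclideanSpace ℝ (Fin 3)

/-- The Hilbert space `L²(ℝ³; ℂ)`. -/
abbrev L2 : Type := Lp ℂ 2 (volume : Measure R3)

/-- The norm of `C^{0,r}(ℝ³)`: the supremum of `|V|` plus the `r`-Hölder seminorm, in `[0, ∞]`. -/
def c0HolderNorm (r : ℝ≥0) (V : R3 → ℝ) : ℝ≥0∞ :=
  (⨆ x, ‖V x‖ₑ) + eHolderNorm r V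

/-! ### Töplitz quantization -/

/-- The coherent state
`φ_{(q,p)}(x) = (π hbar)^{-3/4} exp (-|x - q|² / (2 hbar)) exp (i p · x / hbar)`. -/
def coherentState (hbar : ℝ) (q p x : R3) : ℂ :=
  (((Real.pi * hbar) ^ (-(3 / 4) : ℝ) : ℝ) : ℂ)
    * Complex.exp (((-(‖x - q‖ ^ 2 / (2 * hbar)) : ℝ) : ℂ))
    * Complex.exp (Complex.I * ((inner ℝ p x / hbar : ℝ) : ℂ))

/-- The `L²` pairing `⟨φ_{(q,p)} | ψ⟩` (conjugate-linear in the first slot). -/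
def coherentCoeff (hbar : ℝ) (q p : R3) (ψ : L2) : ℂ :=
  ∫ x, (starRingEnd ℂ) (coherentState hbar q p x) * ψ x

/-- The integrand `f(q,p) ⟨χ | φ_{(q,p)}⟩ ⟨φ_{(q,p)} | ψ⟩` over the phase space. -/
def toplitzIntegrand (hbar : ℝ) (f : R3 × R3 → ℝ) (χ ψ : L2) (z : R3 × R3) : ℂ :=
  (f z : ℂ) * ((starRingEnd ℂ) (coherentCoeff hbar z.1 z.2 χ) * coherentCoeff hbar z.1 z.2 ψ)

/-- `A` is the (unique) bounded operator
`(2 π hbar)⁻³ ∫ |φ_{(q,p)}⟩⟨φ_{(q,p)}| f(q,p) dq dp`, the integral being a weak one. -/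
def IsToplitz (hbar : ℝ) (f : R3 × R3 → ℝ) (A : L2 →L[ℂ] L2) : Prop :=
  ∀ χ ψ : L2, Integrable (toplitzIntegrand hbar f χ ψ) ∧
    inner ℂ χ (A ψ) =
      ((((2 * Real.pi * hbar) ^ 3)⁻¹ : ℝ) : ℂ) * ∫ z, toplitzIntegrand hbar f χ ψ z

open scoped Classical in
/-- The Töplitz quantization `Op^T_hbar[f]` (zero if the defining integral gives no bounded
operator). -/
def toplitz (hbar : ℝ) (f : R3 × R3 → ℝ) : L2 →L[ℂ] L2 :=
  if h : ∃ A, IsToplitz hbar f A then h.choose else 0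

/-! ### Schrödinger operators -/

theorem l2_toDistribution_injective {f g : L2} (h : (f : 𝓢'(R3, ℂ)) = (g : 𝓢'(R3, ℂ))) :
    f = g := by
  have hk := Lp.ker_toTemperedDistributionCLM_eq_bot (F := ℂ) (μ := (volume : Measure R3)) (p := 2)
  exact LinearMap.ker_eq_bot.1 hk h

/-- The Sobolev space `H²(ℝ³)` as a subspace of `L²(ℝ³)`. -/
def sobolevH2 : Submodule ℂ L2 where
  carrier := {ψ | TemperedDistribution.MemSobolev 2 2 (ψ : 𝓢'(R3, ℂ))}
  zero_mem' := by
    have h : ((0 : L2) : 𝓢'(R3, ℂ)) = 0 := (Lp.toTemperedDistributionCLM ℂ volume 2).map_zero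
    simp only [mem_ofPred_eq, h]
    exact TemperedDistribution.memSobolev_fun_zero _ _ _ _
  add_mem' {f g} hf hg := by
    have h : ((f + g : L2) : 𝓢'(R3, ℂ)) = (f : 𝓢'(R3, ℂ)) + (g : 𝓢'(R3, ℂ)) :=
      (Lp.toTemperedDistributionCLM ℂ volume 2).map_add f g
    simp only [mem_ofPred_eq, h] at *
    exact hf.add hg
  smul_mem' c f hf := by
    have h : ((c • f : L2) : 𝓢'(R3, ℂ)) = c • (f : 𝓢'(R3, ℂ)) :=
      (Lp.toTemperedDistributionCLM ℂ volume 2).map_smul c f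
    simp only [mem_ofPred_eq, h] at *
    exact hf.smul c

theorem exists_laplacian (ψ : sobolevH2) :
    ∃ d : L2, (d : 𝓢'(R3, ℂ)) = Δ ((ψ : L2) : 𝓢'(R3, ℂ)) := by
  have h := TemperedDistribution.MemSobolev.laplacian ψ.2
  rw [sub_self, TemperedDistribution.memSobolev_zero_iff] at h
  obtain ⟨d, hd⟩ := h
  exact ⟨d, hd.symm⟩

/-- The distributional Laplacian on `L²(ℝ³)` with domain `H²(ℝ³)`. -/
def laplacianL2 : L2 →ₗ.[ℂ] L2 where
  domain := sobolevH2
  toFun :=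
    { toFun := fun ψ => (exists_laplacian ψ).choose
      map_add' := fun f g => by
        apply l2_toDistribution_injective
        have h : ∀ u v : L2, ((u + v : L2) : 𝓢'(R3, ℂ)) = (u : 𝓢'(R3, ℂ)) + (v : 𝓢'(R3, ℂ)) :=
          (Lp.toTemperedDistributionCLM ℂ volume 2).map_add
        rw [h, (exists_laplacian f).choose_spec, (exists_laplacian g).choose_spec,
          (exists_laplacian (f + g)).choose_spec, Submodule.coe_add, h]
        simp only [← TemperedDistribution.laplacianCLM_apply, map_add]
      map_smul' := fun c f => by
        apply l2_toDistribution_injective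
        have h : ∀ u : L2, ((c • u : L2) : 𝓢'(R3, ℂ)) = c • (u : 𝓢'(R3, ℂ)) :=
          (Lp.toTemperedDistributionCLM ℂ volume 2).map_smul c
        rw [RingHom.id_apply, h, (exists_laplacian f).choose_spec,
          (exists_laplacian (c • f)).choose_spec, Submodule.coe_smul, h]
        simp only [← TemperedDistribution.laplacianCLM_apply, map_smul] }

open scoped Classical in
/-- Multiplication by an essentially bounded real function on `L²(ℝ³)`
(zero if the function is not essentially bounded and measurable). -/
def mulOp (V : R3 → ℝ) : L2 →L[ℂ] L2 :=
  if h : MemLp (fun x => (V x : ℂ)) ⊤ (volume : Measure R3) then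
    (ContinuousLinearMap.mul ℂ ℂ).holderL volume ⊤ 2 2 (h.toLp _)
  else 0

theorem mulOp_apply_ae {V : R3 → ℝ} (h : MemLp (fun x => (V x : ℂ)) ⊤ (volume : Measure R3))
    (ψ : L2) : mulOp V ψ =ᵐ[volume] fun x => (V x : ℂ) * ψ x := by
  have e : mulOp V ψ = (ContinuousLinearMap.mul ℂ ℂ).holder 2 (h.toLp _) ψ := by
    rw [mulOp, dif_pos h]; rfl
  rw [e]
  filter_upwards [(ContinuousLinearMap.mul ℂ ℂ).coeFn_holder (r := 2) (h.toLp _) ψ,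
    h.coeFn_toLp] with x h1 h2
  rw [h1, h2]; rfl

/-- The Schrödinger operator `-(hbar²/2) Δ + V` on `L²(ℝ³)` with domain `H²(ℝ³)`. -/
def schrodinger (hbar : ℝ) (V : R3 → ℝ) : L2 →ₗ.[ℂ] L2 :=
  (mulOp V : L2 →ₗ[ℂ] L2) +ᵥ ((-((hbar ^ 2 / 2 : ℝ) : ℂ)) • laplacianL2)

/-! ### Functional calculus of an unbounded self-adjoint operator -/

section FunctionalCalculus

variable {H : Type*} [NormedAddCommGroup H] [InnerProductSpace ℂ H] [CompleteSpace H]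

/-- `R` is the bounded, everywhere defined inverse of `T - z`. -/
def IsResolvent (T : H →ₗ.[ℂ] H) (z : ℂ) (R : H →L[ℂ] H) : Prop :=
  (∀ x : T.domain, R (T x - z • (x : H)) = x) ∧
    ∀ y : H, ∃ x : T.domain, (x : H) = R y ∧ T x - z • (x : H) = y

open scoped Classical in
/-- The resolvent `(T - z)⁻¹` (zero if `z` is not in the resolvent set). -/
def resolventOp (T : H →ₗ.[ℂ] H) (z : ℂ) : H →L[ℂ] H :=
  if h : ∃ R, IsResolvent T z R then h.choose else 0

/-- The function `f` of `t`, rewritten as a function of `w = (t + i)⁻¹`; the value at `w = 0`, which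
corresponds to `t = ±∞`, is `0`. -/
def resolventCoord (f : ℝ → ℝ) (w : ℂ) : ℂ :=
  if w = 0 then 0 else ((f (w⁻¹).re : ℝ) : ℂ)

/-- `f(T)` for an unbounded self-adjoint `T` and a function `f` that is continuous on the spectrum of
`T` and vanishes at infinity along it: the continuous functional calculus of the bounded normal
operator `(T + i)⁻¹`, whose spectrum away from `0` is the set of the `(t + i)⁻¹` with `t` in the
spectrum of `T`, applied to `f` read in the coordinate `w = (t + i)⁻¹`. It is the unique extension of
`(t + i)⁻¹ ↦ (T + i)⁻¹` to a star-homomorphism on these functions. -/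
def functionalCalculus (f : ℝ → ℝ) (T : H →ₗ.[ℂ] H) : H →L[ℂ] H :=
  cfc (resolventCoord f) (resolventOp T (-Complex.I))

/-- The condition under which `functionalCalculus f T` is meaningful: `T` is self-adjoint,
`(T + i)⁻¹` exists as a bounded operator, and `f` is continuous on the spectrum of `T` and vanishes
at infinity along it. -/
def HasFunctionalCalculus (f : ℝ → ℝ) (T : H →ₗ.[ℂ] H) : Prop :=
  IsSelfAdjoint T ∧ IsResolvent T (-Complex.I) (resolventOp T (-Complex.I)) ∧
    IsStarNormal (resolventOp T (-Complex.I)) ∧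
    ContinuousOn (resolventCoord f) (spectrum ℂ (resolventOp T (-Complex.I)))

end FunctionalCalculus

end

end Semiclassical

open Semiclassical

/-!
Let `H = -(ħ²/2) Δ + V` and `h(q, p) = |p|²/2 + V(q)` be the quantum and the classical Hamiltonian,
and let `C` bound the sup norms and the Hölder constants of all the potentials. The coherent state
transform `W ψ (q, p) = (2πħ)^{-3/2} ⟨φ_{(q,p)} | ψ⟩` is an isometry from `L²(ℝ³)` to `L²(ℝ⁶)`, by
Plancherel's identity in `p` for each fixed `q`, and `Op^T[f] = W† f W`, with `f` acting by
multiplication (`isToplitz_compression`).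

Both Hamiltonians are bounded below by `-C`, so `A = (H + C + 1)⁻¹` and `g = (h + C + 1)⁻¹` are a
self-adjoint operator with spectrum in `[0, 1]` and a function with values in `(0, 1]`. The operator
`A` is obtained from the free resolvent, a Fourier multiplier with range in `H²`, by a Neumann
series (`exists_isResolvent_schrodinger`). A function `f` of the energy that is continuous and
vanishes near `+∞` is `f(t) = F((t + C + 1)⁻¹)` with `F` continuous on `[0, 1]` and `F(0) = 0`.
Hence `f(h) = F(g)`, and `f(H) = F(A)` by the composition property of the continuous functional
calculus (`IsResolvent.functionalCalculus`).

The analytic core is the estimate `‖g W - W A‖ ≤ O(ħ^{1/10})` (`norm_intertwining_le`). On the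
domain of `H`, explicit differentiation of the Gaussian writes `W H ψ - h W ψ` as a sum of windowed
Fourier transforms of `ψ` whose windows carry one of the factors `V(x) - V(q)`, `3ħ/2 - |x - q|²/2`
and `-i p · (x - q)` (`windowTransform_schrodinger`). The width `√ħ` of the Gaussian makes the
first factor `O(ħ^{1/10})` by Hölder continuity, the second one `O(ħ)` and `x - q` of order `√ħ`;
the unbounded momentum in the last factor is absorbed by `|g p| ≤ 1`.

The set of `F` in `C([0, 1])` for which `F(g) W - W F(A) → 0` in norm is a closed subalgebra, and it
contains the coordinate function, so it is everything by the Weierstrass theorem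
(`tendsto_norm_intertwining`). Multiplying by `W†` gives `W† F(g) W - F(A) → 0` for a fixed `F`. The
symbol `F_ħ` of `t ↦ α(-μ_ħ - t)` converges uniformly to that of `t ↦ α(-μ - t)`, because `α` is
uniformly continuous on half-lines bounded above (`tendsto_norm_resolventSymbol_sub`), and both
quantizations are contractions in `F`.
-/

namespace Semiclassical

/-! ### Functional calculus of an operator with a bounded positive resolvent -/

section Resolvent

variable {H : Type*} [NormedAddCommGroup H] [InnerProductSpace ℂ H]

theorem IsResolvent.unique {T : H →ₗ.[ℂ] H} {z : ℂ} {R S : H →L[ℂ] H}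
    (hR : IsResolvent T z R) (hS : IsResolvent T z S) : R = S := by
  ext y
  obtain ⟨x, hx, hy⟩ := hS.2 y
  rw [← hx, ← hR.1 x, hy]

theorem IsResolvent.resolventOp_eq {T : H →ₗ.[ℂ] H} {z : ℂ} {R : H →L[ℂ] H}
    (hR : IsResolvent T z R) : resolventOp T z = R := by
  have h : ∃ R, IsResolvent T z R := ⟨R, hR⟩
  rw [resolventOp, dif_pos h]
  exact h.choose_spec.unique hR

/-- The hypothesis is the operator inequality `A² ≤ A` for a self-adjoint `A`, that is, `0 ≤ A ≤ 1`;
in this form it passes to perturbed resolvents. -/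
theorem norm_apply_le_of_sq_le_re_inner {A : H →L[ℂ] H}
    (hpos : ∀ y, ‖A y‖ ^ 2 ≤ (inner ℂ y (A y)).re) (y : H) : ‖A y‖ ≤ ‖y‖ := by
  have h1 : (inner ℂ y (A y)).re ≤ ‖y‖ * ‖A y‖ := re_inner_le_norm (𝕜 := ℂ) y (A y)
  have h2 := hpos y
  by_contra! h
  nlinarith [norm_nonneg y, norm_nonneg (A y)]

variable [CompleteSpace H]

/-- An operator with a bounded self-adjoint resolvent at a real point is self-adjoint. -/
theorem IsResolvent.isSelfAdjoint {T : H →ₗ.[ℂ] H} {c : ℝ} {A : H →L[ℂ] H}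
    (hA : IsResolvent T (c : ℂ) A) (hsa : IsSelfAdjoint A) : IsSelfAdjoint T := by
  have hsym : ∀ x y, inner ℂ (A x) y = inner ℂ x (A y) := fun x y => by
    rw [← ContinuousLinearMap.adjoint_inner_left, hsa.adjoint_eq]
  -- `A` maps onto the domain of `T`, and it is injective, so that its range is dense.
  have hmem : ∀ y, A y ∈ T.domain := fun y => by
    obtain ⟨x, hx, -⟩ := hA.2 y
    rw [← hx]; exact x.2
  have hTA : ∀ y, T ⟨A y, hmem y⟩ - (c : ℂ) • A y = y := fun y => by
    obtain ⟨x, hx, hy⟩ := hA.2 y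
    have : (⟨A y, hmem y⟩ : T.domain) = x := Subtype.ext hx.symm
    rw [this, ← hx, hy]
  have hdense : Dense (T.domain : Set H) := by
    rw [Submodule.dense_iff_topologicalClosure_eq_top,
      Submodule.topologicalClosure_eq_top_iff, Submodule.eq_bot_iff]
    intro y hy
    have h0 : A y = 0 := by
      refine ext_inner_left ℂ fun v => ?_
      rw [← hsym, inner_zero_right]
      exact (Submodule.mem_orthogonal _ _).1 hy _ (hmem v)
    have h := hTA y
    have h1 : (⟨A y, hmem y⟩ : T.domain) = 0 := Subtype.ext h0
    rw [h1, h0, LinearPMap.map_zero, smul_zero, sub_zero] at h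
    exact h.symm
  have hform : T.IsFormalAdjoint T := by
    intro x y
    have h1 : ∀ x : T.domain, T x = (T x - (c : ℂ) • (x : H)) + (c : ℂ) • (x : H) := fun x => by
      abel
    rw [h1 x, h1 y, inner_add_left, inner_add_right, inner_smul_left, inner_smul_right,
      Complex.conj_ofReal]
    congr 1
    conv_lhs => rw [← hA.1 y]
    conv_rhs => rw [← hA.1 x]
    rw [hsym]
  have hle : T ≤ T.adjoint := hform.le_adjoint hdense
  rw [LinearPMap.isSelfAdjoint_def]
  refine le_antisymm ?_ hle
  have hdom : T.adjoint.domain ≤ T.domain := by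
    intro y hy
    set z := T.adjoint ⟨y, hy⟩ - (c : ℂ) • y with hz
    have key : y = A z := by
      refine ext_inner_right ℂ fun v => ?_
      have h1 := LinearPMap.adjoint_isFormalAdjoint hdense ⟨y, hy⟩ ⟨A v, hmem v⟩
      rw [hsym, hz, inner_sub_left, h1, inner_smul_left, Complex.conj_ofReal,
        ← inner_smul_right, ← inner_sub_right, hTA]
    rw [key]; exact hmem z
  refine ⟨hdom, fun x y hxy => ?_⟩
  have := hle.2 (x := y) (y := x) hxy.symm
  exact this.symm

theorem spectrum_subset_Icc_of_sq_le_re_inner {A : H →L[ℂ] H} (hsa : IsSelfAdjoint A)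
    (hpos : ∀ y, ‖A y‖ ^ 2 ≤ (inner ℂ y (A y)).re) : spectrum ℝ A ⊆ Icc 0 1 := by
  have hA : 0 ≤ A := by
    rw [ContinuousLinearMap.nonneg_iff_isPositive, ContinuousLinearMap.isPositive_def]
    refine ⟨hsa.isSymmetric, fun x => ?_⟩
    rw [ContinuousLinearMap.reApplyInnerSelf_apply, ← inner_re_symm]
    exact (sq_nonneg _).trans (hpos x)
  have hn : ‖A‖ ≤ 1 := A.opNorm_le_bound zero_le_one fun y => by
    rw [one_mul]; exact norm_apply_le_of_sq_le_re_inner hpos y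
  intro s hs
  refine ⟨spectrum_nonneg_of_nonneg hA hs, ?_⟩
  obtain _ | _ := subsingleton_or_nontrivial H
  · have : Subsingleton (H →L[ℂ] H) := ⟨fun f g => by ext x; exact Subsingleton.elim _ _⟩
    simp at hs
  · exact (le_abs_self s).trans ((spectrum.norm_le_norm_of_mem hs).trans hn)

/-- The Möbius transformation that carries `(t + c)⁻¹` to `(t + i)⁻¹`. -/
noncomputable def resolventMoebius (c : ℝ) (z : ℂ) : ℂ := z * (1 + (Complex.I - c) * z)⁻¹

theorem one_add_mul_ofReal_ne_zero (c s : ℝ) : 1 + (Complex.I - c) * (s : ℂ) ≠ 0 := by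
  intro h
  have him := congrArg Complex.im h
  have hre := congrArg Complex.re h
  simp at him hre
  simp [him] at hre

theorem mem_spectrum_complex {A : H →L[ℂ] H} (hsa : IsSelfAdjoint A) {z : ℂ}
    (hz : z ∈ spectrum ℂ A) : ∃ s ∈ spectrum ℝ A, z = (s : ℂ) := by
  have h := hsa.spectrumRestricts
  refine ⟨z.re, h.apply_mem hz, (h.rightInvOn hz).symm⟩

theorem continuousOn_inv_one_add {A : H →L[ℂ] H} (hsa : IsSelfAdjoint A) (c : ℝ) :
    ContinuousOn (fun z : ℂ => (1 + (Complex.I - c) * z)⁻¹) (spectrum ℂ A) := by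
  refine ContinuousOn.inv₀ (by fun_prop) fun z hz => ?_
  obtain ⟨s, -, rfl⟩ := mem_spectrum_complex hsa hz
  exact one_add_mul_ofReal_ne_zero c s

theorem continuousOn_resolventMoebius {A : H →L[ℂ] H} (hsa : IsSelfAdjoint A) (c : ℝ) :
    ContinuousOn (resolventMoebius c) (spectrum ℂ A) :=
  continuousOn_id.mul (continuousOn_inv_one_add hsa c)

/-- The first resolvent identity, solved for the resolvent at `-i`. -/
theorem IsResolvent.neg_I {T : H →ₗ.[ℂ] H} {c : ℝ} {A : H →L[ℂ] H}
    (hA : IsResolvent T (-(c : ℂ)) A) (hsa : IsSelfAdjoint A) :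
    IsResolvent T (-Complex.I) (cfc (resolventMoebius c) A) := by
  have hn : IsStarNormal A := hsa.isStarNormal
  have hcont := continuousOn_inv_one_add hsa c
  set b := cfc (fun z : ℂ => (1 + (Complex.I - c) * z)⁻¹) A with hb
  have hR : cfc (resolventMoebius c) A = A * b := by
    change cfc (fun z : ℂ => z * (1 + (Complex.I - c) * z)⁻¹) A = _
    rw [cfc_mul (fun z : ℂ => z) _ A, cfc_id' ℂ A]
  have hD : cfc (fun z : ℂ => 1 + (Complex.I - c) * z) A = 1 + (Complex.I - (c : ℂ)) • A := by
    rw [cfc_add A (fun _ : ℂ => (1 : ℂ)) (fun z : ℂ => (Complex.I - c) * z),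
      cfc_const_mul _ (fun z : ℂ => z) A, cfc_id' ℂ A, cfc_const_one ℂ A]
  have hbD : b * (1 + (Complex.I - (c : ℂ)) • A) = 1 := by
    rw [← hD, hb, ← cfc_mul _ _ A, ← cfc_const_one ℂ A]
    refine cfc_congr fun z hz => ?_
    obtain ⟨s, -, rfl⟩ := mem_spectrum_complex hsa hz
    exact inv_mul_cancel₀ (one_add_mul_ofReal_ne_zero c s)
  have hDb : (1 + (Complex.I - (c : ℂ)) • A) * b = 1 := by
    rw [← hD, hb, ← cfc_mul _ _ A, ← cfc_const_one ℂ A]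
    refine cfc_congr fun z hz => ?_
    obtain ⟨s, -, rfl⟩ := mem_spectrum_complex hsa hz
    exact mul_inv_cancel₀ (one_add_mul_ofReal_ne_zero c s)
  rw [hR]
  constructor
  · intro x
    have hx := hA.1 x
    set y := T x - (-(c : ℂ)) • (x : H) with hy
    have e : T x - (-Complex.I) • (x : H) = (1 + (Complex.I - (c : ℂ)) • A) y := by
      simp only [add_apply, one_apply_eq_self,
        smul_apply, hx]
      rw [hy]; module
    rw [e, ← mul_apply_eq_comp, mul_assoc, hbD, mul_one, hx]
  · intro y
    obtain ⟨x, hx, hxy⟩ := hA.2 (b y)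
    refine ⟨x, by rw [hx]; rfl, ?_⟩
    have e : T x - (-Complex.I) • (x : H) = (1 + (Complex.I - (c : ℂ)) • A) (b y) := by
      simp only [add_apply, one_apply_eq_self,
        smul_apply, ← hx]
      rw [← hxy]; module
    rw [e, ← mul_apply_eq_comp, hDb, one_apply_eq_self]

theorem resolventMoebius_ofReal_eq_zero_iff (c s : ℝ) :
    resolventMoebius c (s : ℂ) = 0 ↔ s = 0 := by
  simp [resolventMoebius, one_add_mul_ofReal_ne_zero]

theorem inv_resolventMoebius_ofReal {c s : ℝ} (hs : s ≠ 0) :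
    (resolventMoebius c (s : ℂ))⁻¹ = ((s⁻¹ - c : ℝ) : ℂ) + Complex.I := by
  have hs' : (s : ℂ) ≠ 0 := by exact_mod_cast hs
  rw [resolventMoebius, mul_inv, inv_inv]
  push_cast
  field_simp
  ring

/-- The function `f` of `t`, read in the coordinate `s = (t + c)⁻¹`, with the value `0` at the
point `s = 0` that corresponds to `t = ∞`. -/
noncomputable def shiftedResolventCoord (c : ℝ) (f : ℝ → ℝ) (s : ℝ) : ℝ :=
  if s = 0 then 0 else f (s⁻¹ - c)

theorem resolventCoord_resolventMoebius (c : ℝ) (f : ℝ → ℝ) (s : ℝ) :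
    resolventCoord f (resolventMoebius c (s : ℂ)) = (shiftedResolventCoord c f s : ℂ) := by
  rw [resolventCoord, shiftedResolventCoord]
  by_cases hs : s = 0
  · simp [hs, resolventMoebius]
  · rw [if_neg (by rwa [resolventMoebius_ofReal_eq_zero_iff]), if_neg hs,
      inv_resolventMoebius_ofReal hs]
    simp

theorem continuousOn_shiftedResolventCoord {c : ℝ} {f : ℝ → ℝ} (hf : Continuous f)
    {t₀ : ℝ} (h0 : ∀ t, t₀ ≤ t → f t = 0) :
    ContinuousOn (shiftedResolventCoord c f) (Icc 0 1) := by
  intro s hs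
  rcases eq_or_ne s 0 with rfl | hne
  -- Near `s = 0` the point `t = s⁻¹ - c` lies beyond `t₀`.
  · have hev : ∀ᶠ s in 𝓝[Icc 0 1] (0 : ℝ), shiftedResolventCoord c f s = 0 := by
      have hpos : 0 < (|t₀ + c| + 1)⁻¹ := by positivity
      filter_upwards [mem_nhdsWithin_of_mem_nhds (Iio_mem_nhds hpos), self_mem_nhdsWithin]
        with s hs1 hs2
      rw [shiftedResolventCoord]
      split_ifs with h
      · rfl
      · apply h0
        have hs3 : 0 < s := lt_of_le_of_ne hs2.1 (Ne.symm h)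
        have := (lt_inv_comm₀ hs3 (by positivity)).1 hs1
        linarith [le_abs_self (t₀ + c)]
    refine ContinuousWithinAt.congr_of_eventuallyEq (f := fun _ => (0 : ℝ))
      continuousWithinAt_const hev ?_
    simp [shiftedResolventCoord]
  · have h : ContinuousAt (fun s : ℝ => f (s⁻¹ - c)) s :=
      hf.continuousAt.comp ((continuousAt_inv₀ hne).sub continuousAt_const)
    refine (h.congr ?_).continuousWithinAt
    filter_upwards [isOpen_ne.mem_nhds hne] with s' hs'
    rw [shiftedResolventCoord, if_neg hs']

/-- The set on the right contains the spectrum of `(T + i)⁻¹` if `(T + c)⁻¹` has its spectrum in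
`[0, 1]`. -/
theorem continuousOn_resolventCoord {c : ℝ} {f : ℝ → ℝ} (hf : Continuous f)
    {t₀ : ℝ} (h0 : ∀ t, t₀ ≤ t → f t = 0) :
    ContinuousOn (resolventCoord f) (resolventMoebius c '' (Complex.ofReal '' Icc 0 1)) := by
  rintro w ⟨-, ⟨s, hs, rfl⟩, rfl⟩
  rcases eq_or_ne s 0 with rfl | hne
  · have hw : resolventMoebius c ((0 : ℝ) : ℂ) = 0 := by simp [resolventMoebius]
    rw [hw]
    -- Near `w = 0` the point `t = re (w⁻¹)` is large, because `t` is bounded below on this set.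
    have hev : ∀ᶠ w in 𝓝[resolventMoebius c '' (Complex.ofReal '' Icc 0 1)] (0 : ℂ),
        resolventCoord f w = 0 := by
      have hpos : 0 < (|t₀| + |1 - c| + 2)⁻¹ := by positivity
      filter_upwards [mem_nhdsWithin_of_mem_nhds (Metric.ball_mem_nhds 0 hpos),
        self_mem_nhdsWithin] with w hw1 hw2
      obtain ⟨-, ⟨s, hs, rfl⟩, rfl⟩ := hw2
      rw [resolventCoord_resolventMoebius, shiftedResolventCoord]
      split_ifs with h
      · simp
      · rw [h0, Complex.ofReal_zero]
        have hne : resolventMoebius c (s : ℂ) ≠ 0 := by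
          rwa [Ne, resolventMoebius_ofReal_eq_zero_iff]
        rw [mem_ball_zero_iff] at hw1
        have h2 := (lt_inv_comm₀ (norm_pos_iff.2 hne) (by positivity)).1 hw1
        rw [← norm_inv, inv_resolventMoebius_ofReal h] at h2
        have h3 := h2.trans_le (norm_add_le _ _)
        rw [Complex.norm_I, Complex.norm_real, Real.norm_eq_abs] at h3
        have hs3 : 0 < s := lt_of_le_of_ne hs.1 (Ne.symm h)
        have h4 : 1 ≤ s⁻¹ := (one_le_inv₀ hs3).2 hs.2
        rcases abs_cases (s⁻¹ - c) with h5 | h5 <;> rcases abs_cases (1 - c) with h6 | h6 <;>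
          linarith [le_abs_self t₀, abs_nonneg t₀]
    refine ContinuousWithinAt.congr_of_eventuallyEq (f := fun _ => (0 : ℂ))
      continuousWithinAt_const hev ?_
    simp [resolventCoord]
  · have hne' : resolventMoebius c (s : ℂ) ≠ 0 := by rwa [Ne, resolventMoebius_ofReal_eq_zero_iff]
    have h : ContinuousAt (fun w : ℂ => ((f (w⁻¹).re : ℝ) : ℂ)) (resolventMoebius c (s : ℂ)) :=
      (Complex.continuous_ofReal.comp (hf.comp Complex.continuous_re)).continuousAt.comp
        (continuousAt_inv₀ hne')
    refine (h.congr ?_).continuousWithinAt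
    filter_upwards [isOpen_ne.mem_nhds hne'] with w hw
    rw [resolventCoord, if_neg hw]

/-- If `T + c` has the bounded inverse `A` with spectrum in `[0, 1]`, the functional calculus of `T`
is that of `A`. -/
theorem IsResolvent.functionalCalculus {T : H →ₗ.[ℂ] H} {c : ℝ} {A : H →L[ℂ] H}
    (hA : IsResolvent T (-(c : ℂ)) A) (hsa : IsSelfAdjoint A) (hspec : spectrum ℝ A ⊆ Icc 0 1)
    {f : ℝ → ℝ} (hf : Continuous f) {t₀ : ℝ} (h0 : ∀ t, t₀ ≤ t → f t = 0) :
    HasFunctionalCalculus f T ∧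
      functionalCalculus f T = cfc (shiftedResolventCoord c f) A := by
  have hn : IsStarNormal A := hsa.isStarNormal
  have hI := hA.neg_I hsa
  have hsub : spectrum ℂ A ⊆ Complex.ofReal '' Icc 0 1 := fun z hz => by
    obtain ⟨s, hs, rfl⟩ := mem_spectrum_complex hsa hz
    exact ⟨s, hspec hs, rfl⟩
  have hcont : ContinuousOn (resolventCoord f) (resolventMoebius c '' spectrum ℂ A) :=
    (continuousOn_resolventCoord hf h0).mono (image_mono hsub)
  have hrho := continuousOn_resolventMoebius hsa c
  refine ⟨⟨IsResolvent.isSelfAdjoint (c := -c) (by simpa using hA) hsa, ?_, ?_, ?_⟩, ?_⟩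
  · rw [hI.resolventOp_eq]; exact hI
  · rw [hI.resolventOp_eq]; exact cfc_predicate _ _
  · rw [hI.resolventOp_eq, cfc_map_spectrum (resolventMoebius c) A]
    exact hcont
  · rw [Semiclassical.functionalCalculus, hI.resolventOp_eq, ← cfc_comp _ _ A,
      cfc_real_eq_complex _ hsa]
    refine cfc_congr fun z hz => ?_
    obtain ⟨s, -, rfl⟩ := mem_spectrum_complex hsa hz
    simp [resolventCoord_resolventMoebius]

end Resolvent

/-! ### Resolvents of bounded perturbations -/

section Perturbation

variable {H : Type*} [NormedAddCommGroup H] [InnerProductSpace ℂ H] [CompleteSpace H]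

/-- A bounded self-adjoint perturbation `B` of an operator `T` that satisfies `T ≥ 0`, in the form
`c ‖A₀ y‖² ≤ re ⟨y, A₀ y⟩` for `A₀ = (T + c)⁻¹`: the inverse of `B + T + c` is given by a Neumann
series when `c = C + 1` and `‖B‖ ≤ C`. -/
theorem IsResolvent.vadd {T : H →ₗ.[ℂ] H} {C : ℝ} (hC : 0 ≤ C) {A₀ B : H →L[ℂ] H}
    (hA : IsResolvent T (-((C + 1 : ℝ) : ℂ)) A₀) (hsa : IsSelfAdjoint A₀)
    (hpos : ∀ y, (C + 1) * ‖A₀ y‖ ^ 2 ≤ (inner ℂ y (A₀ y)).re)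
    (hB : IsSelfAdjoint B) (hBC : ‖B‖ ≤ C) :
    ∃ A : H →L[ℂ] H, IsResolvent ((B : H →ₗ[ℂ] H) +ᵥ T) (-((C + 1 : ℝ) : ℂ)) A ∧
      IsSelfAdjoint A ∧ ∀ y, ‖A y‖ ^ 2 ≤ (inner ℂ y (A y)).re := by
  have hA0 : ∀ y, (C + 1) * ‖A₀ y‖ ≤ ‖y‖ := fun y => by
    have h1 : (inner ℂ y (A₀ y)).re ≤ ‖y‖ * ‖A₀ y‖ := re_inner_le_norm (𝕜 := ℂ) y (A₀ y)
    have h2 := hpos y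
    by_contra! h
    nlinarith [norm_nonneg y, norm_nonneg (A₀ y)]
  have hA0n : ‖A₀‖ ≤ (C + 1)⁻¹ := A₀.opNorm_le_bound (by positivity) fun y => by
    rw [inv_mul_eq_div, le_div_iff₀ (by positivity), mul_comm]
    exact hA0 y
  have hlt : ‖-(B * A₀)‖ < 1 := by
    rw [norm_neg]
    calc ‖B * A₀‖ ≤ ‖B‖ * ‖A₀‖ := norm_mul_le _ _
      _ ≤ C * (C + 1)⁻¹ := by gcongr
      _ < 1 := by rw [← div_eq_mul_inv, div_lt_one (by positivity)]; linarith
  set U : (H →L[ℂ] H)ˣ := Units.oneSub (-(B * A₀)) hlt with hU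
  have hUv : (U : H →L[ℂ] H) = 1 + B * A₀ := by simp [hU]
  set N : H →L[ℂ] H := ((U⁻¹ : (H →L[ℂ] H)ˣ) : H →L[ℂ] H) with hN
  have hNU : ∀ z, N (z + B (A₀ z)) = z := fun z => by
    have : (N * (U : H →L[ℂ] H)) z = z := by rw [hN, Units.inv_mul]; rfl
    rw [hUv] at this
    exact this
  have hUN : ∀ y, N y + B (A₀ (N y)) = y := fun y => by
    have : ((U : H →L[ℂ] H) * N) y = y := by rw [hN, Units.mul_inv]; rfl
    rw [hUv] at this
    exact this
  have hsym : ∀ x y, inner ℂ (A₀ x) y = inner ℂ x (A₀ y) := fun x y => by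
    rw [← ContinuousLinearMap.adjoint_inner_left, hsa.adjoint_eq]
  have hsymB : ∀ x y, inner ℂ (B x) y = inner ℂ x (B y) := fun x y => by
    rw [← ContinuousLinearMap.adjoint_inner_left, hB.adjoint_eq]
  have happ : ∀ x : T.domain, ((B : H →ₗ[ℂ] H) +ᵥ T) x = B (x : H) + T x := fun x => rfl
  refine ⟨A₀ * N, ⟨fun x => ?_, fun y => ?_⟩, ?_, fun y => ?_⟩
  · have hx := hA.1 x
    rw [happ]
    set y := T x - (-((C + 1 : ℝ) : ℂ)) • (x : H) with hy
    have e : B (x : H) + T x - (-((C + 1 : ℝ) : ℂ)) • (x : H) = y + B (A₀ y) := by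
      rw [hx, hy]; abel
    rw [e, mul_apply_eq_comp, hNU, hx]
  · obtain ⟨x, hx, hxy⟩ := hA.2 (N y)
    refine ⟨x, hx, ?_⟩
    rw [happ, add_sub_assoc, hxy, hx, add_comm, hUN]
  · rw [ContinuousLinearMap.isSelfAdjoint_iff_isSymmetric]
    intro x y
    change inner ℂ (A₀ (N x)) y = inner ℂ x (A₀ (N y))
    conv_lhs => rw [← hUN y]
    conv_rhs => rw [← hUN x]
    rw [inner_add_left, inner_add_right, hsym, hsymB]
  · change ‖A₀ (N y)‖ ^ 2 ≤ (inner ℂ y (A₀ (N y))).re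
    have h0 : (inner ℂ y (A₀ (N y))).re =
        (inner ℂ (N y) (A₀ (N y))).re + (inner ℂ (B (A₀ (N y))) (A₀ (N y))).re := by
      rw [← Complex.add_re, ← inner_add_left, hUN]
    have h1 := hpos (N y)
    have h2 : |(inner ℂ (B (A₀ (N y))) (A₀ (N y))).re| ≤ C * ‖A₀ (N y)‖ ^ 2 := by
      refine (Complex.abs_re_le_norm _).trans ((norm_inner_le_norm _ _).trans ?_)
      rw [sq, ← mul_assoc]
      gcongr
      exact (B.le_opNorm _).trans (by gcongr)
    linarith [neg_le_of_abs_le h2]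

end Perturbation

/-! ### Multiplication operators on `L²` -/

section Multiplication

variable {X : Type*} [MeasurableSpace X] {μ : Measure X}

/-- Multiplication by an essentially bounded function on `L²(μ)`. -/
noncomputable def mulLp {g : X → ℂ} (hg : MemLp g ⊤ μ) : Lp ℂ 2 μ →L[ℂ] Lp ℂ 2 μ :=
  (ContinuousLinearMap.mul ℂ ℂ).holderL μ ⊤ 2 2 (hg.toLp _)

theorem mulLp_apply_ae {g : X → ℂ} (hg : MemLp g ⊤ μ) (u : Lp ℂ 2 μ) :
    mulLp hg u =ᵐ[μ] fun x => g x * u x := by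
  have e : mulLp hg u = (ContinuousLinearMap.mul ℂ ℂ).holder 2 (hg.toLp _) u := rfl
  rw [e]
  filter_upwards [(ContinuousLinearMap.mul ℂ ℂ).coeFn_holder (r := 2) (hg.toLp _) u,
    hg.coeFn_toLp] with x h1 h2
  rw [h1, h2]; rfl

theorem mulLp_apply_eq_smul {g : X → ℂ} (hg : MemLp g ⊤ μ) (u : Lp ℂ 2 μ) :
    mulLp hg u = (hg.toLp _ • u : Lp ℂ 2 μ) := by
  refine Lp.ext ?_
  filter_upwards [mulLp_apply_ae hg u, Lp.coeFn_lpSMul (r := 2) (hg.toLp _) u, hg.coeFn_toLp]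
    with x h1 h2 h3
  rw [h1, h2, Pi.smul_apply', h3, smul_eq_mul]

theorem norm_mulLp_le {g : X → ℂ} (hg : MemLp g ⊤ μ) {C : ℝ} (hC : 0 ≤ C)
    (h : ∀ᵐ x ∂μ, ‖g x‖ ≤ C) : ‖mulLp hg‖ ≤ C := by
  refine ContinuousLinearMap.opNorm_le_bound _ hC fun u => ?_
  refine Lp.norm_le_mul_norm_of_ae_le_mul ?_
  filter_upwards [mulLp_apply_ae hg u, h] with x h1 h2
  rw [h1, norm_mul]
  gcongr

theorem isSelfAdjoint_mulLp {g : X → ℝ} (hg : MemLp (fun x => (g x : ℂ)) ⊤ μ) :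
    IsSelfAdjoint (mulLp hg) := by
  rw [ContinuousLinearMap.isSelfAdjoint_iff_isSymmetric]
  intro u v
  change inner ℂ (mulLp hg u) v = inner ℂ u (mulLp hg v)
  rw [L2.inner_def, L2.inner_def]
  refine integral_congr_ae ?_
  filter_upwards [mulLp_apply_ae hg u, mulLp_apply_ae hg v] with x h1 h2
  rw [h1, h2]
  simp only [RCLike.inner_apply, map_mul, Complex.conj_ofReal]
  ring

/-- The pointwise inequality `c g² ≤ g`, integrated against `|u|²`. -/
theorem mul_norm_mulLp_sq_le_re_inner {g : X → ℝ} (hg : MemLp (fun x => (g x : ℂ)) ⊤ μ)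
    (h0 : ∀ x, 0 ≤ g x) {c : ℝ} (hc : ∀ x, c * g x ≤ 1) (u : Lp ℂ 2 μ) :
    c * ‖mulLp hg u‖ ^ 2 ≤ (inner ℂ u (mulLp hg u)).re := by
  have e : ‖mulLp hg u‖ ^ 2 = (inner ℂ (mulLp hg u) (mulLp hg u)).re :=
    (inner_self_eq_norm_sq (𝕜 := ℂ) _).symm
  have hi := fun v w : Lp ℂ 2 μ => L2.integrable_inner (𝕜 := ℂ) v w
  rw [e, L2.inner_def, L2.inner_def]
  simp only [← RCLike.re_to_complex]
  rw [← integral_re (hi _ _), ← integral_re (hi _ _), ← integral_const_mul]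
  refine integral_mono_ae ((hi _ _).re.const_mul c) (hi _ _).re ?_
  filter_upwards [mulLp_apply_ae hg u] with x h1
  simp only [h1, RCLike.inner_apply, map_mul, Complex.conj_ofReal]
  have e1 : (g x : ℂ) * u x * ((g x : ℂ) * (starRingEnd ℂ) (u x))
      = ((g x ^ 2 * ‖u x‖ ^ 2 : ℝ) : ℂ) := by
    push_cast; rw [← Complex.mul_conj']; ring
  have e2 : (g x : ℂ) * u x * (starRingEnd ℂ) (u x) = ((g x * ‖u x‖ ^ 2 : ℝ) : ℂ) := by
    push_cast; rw [← Complex.mul_conj']; ring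
  rw [e1, e2]
  simp only [Complex.ofReal_re, RCLike.re_to_complex]
  nlinarith [mul_nonneg (mul_nonneg (h0 x) (sq_nonneg ‖u x‖)) (sub_nonneg.2 (hc x))]

end Multiplication

/-! ### The resolvents of the free and the perturbed Schrödinger operator -/

section FreeResolvent

open FourierTransform

/-- The symbol `(κ |ξ|² + c)⁻¹` of the free resolvent. -/
noncomputable def freeSymbol (κ c : ℝ) (ξ : R3) : ℝ := (κ * ‖ξ‖ ^ 2 + c)⁻¹

theorem freeSymbol_nonneg {κ c : ℝ} (hκ : 0 ≤ κ) (hc : 0 ≤ c) (ξ : R3) : 0 ≤ freeSymbol κ c ξ := by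
  unfold freeSymbol; positivity

theorem mul_freeSymbol_le_one {κ c : ℝ} (hκ : 0 ≤ κ) (hc : 0 < c) (ξ : R3) :
    c * freeSymbol κ c ξ ≤ 1 := by
  unfold freeSymbol
  rw [← div_eq_mul_inv, div_le_one (by positivity)]
  have : 0 ≤ κ * ‖ξ‖ ^ 2 := by positivity
  linarith

theorem hasTemperateGrowth_freeSymbol {κ c : ℝ} (hκ : 0 ≤ κ) (hc : 0 < c) :
    (fun ξ => (freeSymbol κ c ξ : ℂ)).HasTemperateGrowth := by
  have e : (fun ξ => (freeSymbol κ c ξ : ℂ)) =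
      fun ξ : R3 => ((c⁻¹ * (1 + ‖Real.sqrt (κ / c) • ξ‖ ^ 2) ^ (-1 : ℝ) : ℝ) : ℂ) := by
    ext ξ
    congr 1
    rw [freeSymbol, norm_smul, mul_pow, Real.norm_eq_abs, sq_abs,
      Real.sq_sqrt (by positivity), Real.rpow_neg_one, ← mul_inv]
    congr 1
    field_simp
    ring
  rw [e]
  have h1 : (fun ξ : R3 => (1 + ‖Real.sqrt (κ / c) • ξ‖ ^ 2) ^ (-1 : ℝ)).HasTemperateGrowth :=
    (Function.hasTemperateGrowth_one_add_norm_sq_rpow R3 (-1)).comp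
      ((Real.sqrt (κ / c)) • ContinuousLinearMap.id ℝ R3).hasTemperateGrowth
  exact Function.Complex.hasTemperateGrowth_ofReal.comp
    ((Function.HasTemperateGrowth.const _).mul h1)

theorem memLp_top_ofReal {X : Type*} [MeasurableSpace X] {μ : Measure X} {g : X → ℝ}
    (hg : AEStronglyMeasurable g μ) {C : ℝ} (hC : ∀ x, |g x| ≤ C) :
    MemLp (fun x => (g x : ℂ)) ⊤ μ :=
  memLp_top_of_bound (Complex.continuous_ofReal.comp_aestronglyMeasurable hg) C
    (ae_of_all _ fun x => by simpa using hC x)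

theorem memLp_freeSymbol {κ c : ℝ} (hκ : 0 ≤ κ) (hc : 0 < c) :
    MemLp (fun ξ => (freeSymbol κ c ξ : ℂ)) ⊤ (volume : Measure R3) := by
  refine memLp_top_ofReal (C := c⁻¹) ?_ fun ξ => ?_
  · refine Measurable.aestronglyMeasurable ?_
    unfold freeSymbol
    fun_prop
  · rw [abs_of_nonneg (freeSymbol_nonneg hκ hc.le ξ), ← mul_le_mul_iff_right₀ hc,
      mul_inv_cancel₀ hc.ne']
    exact mul_freeSymbol_le_one hκ hc ξ

/-- The free resolvent `(-κ / (4 π²) Δ + c)⁻¹`. The factor `4 π²` comes from the normalization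
`exp (-2 π i x · ξ)` of the Fourier transform. -/
noncomputable def freeResolvent {κ c : ℝ} (hκ : 0 ≤ κ) (hc : 0 < c) : L2 →L[ℂ] L2 :=
  ((Lp.fourierTransformₗᵢ R3 ℂ).symm : L2 →L[ℂ] L2) ∘L mulLp (memLp_freeSymbol hκ hc) ∘L
    ((Lp.fourierTransformₗᵢ R3 ℂ) : L2 →L[ℂ] L2)

theorem freeResolvent_apply {κ c : ℝ} (hκ : 0 ≤ κ) (hc : 0 < c) (y : L2) :
    freeResolvent hκ hc y = 𝓕⁻ (mulLp (memLp_freeSymbol hκ hc) (𝓕 y)) := rfl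

theorem toTemperedDistribution_freeResolvent {κ c : ℝ} (hκ : 0 ≤ κ) (hc : 0 < c) (y : L2) :
    (freeResolvent hκ hc y : 𝓢'(R3, ℂ)) =
      TemperedDistribution.fourierMultiplierCLM ℂ (fun ξ => (freeSymbol κ c ξ : ℂ))
        (y : 𝓢'(R3, ℂ)) := by
  rw [freeResolvent_apply, TemperedDistribution.fourierMultiplierCLM_apply,
    Lp.fourier_toTemperedDistribution_eq, ← Lp.fourierInv_toTemperedDistribution_eq,
    mulLp_apply_eq_smul,
    Lp.toTemperedDistribution_smul_eq (hasTemperateGrowth_freeSymbol hκ hc)]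

theorem isSelfAdjoint_freeResolvent {κ c : ℝ} (hκ : 0 ≤ κ) (hc : 0 < c) :
    IsSelfAdjoint (freeResolvent hκ hc) := by
  rw [ContinuousLinearMap.isSelfAdjoint_iff_isSymmetric]
  intro u v
  change inner ℂ (freeResolvent hκ hc u) v = inner ℂ u (freeResolvent hκ hc v)
  rw [← Lp.inner_fourier_eq, ← Lp.inner_fourier_eq u, freeResolvent_apply, freeResolvent_apply,
    fourier_fourierInv_eq, fourier_fourierInv_eq, ← ContinuousLinearMap.adjoint_inner_left,
    (isSelfAdjoint_mulLp (memLp_freeSymbol hκ hc)).adjoint_eq]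

theorem mul_norm_freeResolvent_sq_le {κ c : ℝ} (hκ : 0 ≤ κ) (hc : 0 < c) (y : L2) :
    c * ‖freeResolvent hκ hc y‖ ^ 2 ≤ (inner ℂ y (freeResolvent hκ hc y)).re := by
  rw [← Lp.inner_fourier_eq, ← Lp.norm_fourier_eq, freeResolvent_apply, fourier_fourierInv_eq]
  exact mul_norm_mulLp_sq_le_re_inner _ (freeSymbol_nonneg hκ hc.le)
    (mul_freeSymbol_le_one hκ hc) _

theorem toTemperedDistribution_add (u v : L2) :
    ((u + v : L2) : 𝓢'(R3, ℂ)) = (u : 𝓢'(R3, ℂ)) + (v : 𝓢'(R3, ℂ)) :=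
  (Lp.toTemperedDistributionCLM ℂ volume 2).map_add u v

theorem toTemperedDistribution_smul (a : ℂ) (u : L2) :
    ((a • u : L2) : 𝓢'(R3, ℂ)) = a • (u : 𝓢'(R3, ℂ)) :=
  (Lp.toTemperedDistributionCLM ℂ volume 2).map_smul a u

theorem toTemperedDistribution_laplacianL2 (x : laplacianL2.domain) :
    (laplacianL2 x : 𝓢'(R3, ℂ)) = Δ ((x : L2) : 𝓢'(R3, ℂ)) :=
  (exists_laplacian x).choose_spec

theorem neg_smul_laplacian_add_smul (a c : ℝ) (f : 𝓢'(R3, ℂ)) :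
    (-(a : ℂ)) • Δ f + (c : ℂ) • f =
      TemperedDistribution.fourierMultiplierCLM ℂ
        (fun ξ => ((a * (2 * Real.pi) ^ 2 * ‖ξ‖ ^ 2 + c : ℝ) : ℂ)) f := by
  have h1 : (fun ξ : R3 => ((a * (2 * Real.pi) ^ 2 * ‖ξ‖ ^ 2 + c : ℝ) : ℂ)) =
      ((a * (2 * Real.pi) ^ 2 : ℝ) : ℂ) • (fun ξ : R3 => Complex.ofReal (‖ξ‖ ^ 2)) +
        fun _ => (c : ℂ) := by
    ext ξ; simp
  rw [TemperedDistribution.laplacian_eq_fourierMultiplierCLM, h1,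
    TemperedDistribution.fourierMultiplierCLM_apply,
    TemperedDistribution.fourierMultiplierCLM_apply,
    TemperedDistribution.smulLeftCLM_add (by fun_prop) (by fun_prop),
    TemperedDistribution.smulLeftCLM_smul (by fun_prop)]
  simp only [add_apply, smul_apply, TemperedDistribution.smulLeftCLM_const,
    FourierTransform.fourierInv_add, FourierTransform.fourierInv_smul,
    FourierTransform.fourierInv_fourier_eq]
  congr 1
  rw [← Complex.coe_smul (-(2 * Real.pi) ^ 2), smul_smul]
  congr 1
  push_cast; ring

theorem fourierMultiplierCLM_eq_self_of_mul_eq_one {g₁ g₂ : R3 → ℂ}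
    (hg₁ : g₁.HasTemperateGrowth) (hg₂ : g₂.HasTemperateGrowth) (h : ∀ ξ, g₁ ξ * g₂ ξ = 1)
    (f : 𝓢'(R3, ℂ)) :
    TemperedDistribution.fourierMultiplierCLM ℂ g₂
      (TemperedDistribution.fourierMultiplierCLM ℂ g₁ f) = f := by
  have e : g₁ * g₂ = fun _ => (1 : ℂ) := funext h
  rw [TemperedDistribution.fourierMultiplierCLM_fourierMultiplierCLM_apply hg₁ hg₂, e,
    TemperedDistribution.fourierMultiplierCLM_const, one_smul]
  rfl

/-- The free resolvent gains two derivatives: `(1 + |ξ|²) (κ |ξ|² + c)⁻¹` is bounded. -/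
theorem memSobolev_freeResolvent {κ c : ℝ} (hκ : 0 < κ) (hc : 0 < c) (y : L2) :
    TemperedDistribution.MemSobolev 2 2 (freeResolvent hκ.le hc y : 𝓢'(R3, ℂ)) := by
  have hy : TemperedDistribution.MemSobolev 0 2 (y : 𝓢'(R3, ℂ)) :=
    TemperedDistribution.memSobolev_zero_iff.2 ⟨y, rfl⟩
  have hg : (fun ξ : R3 => (((1 + ‖ξ‖ ^ 2) ^ ((2 : ℝ) / 2) : ℝ) : ℂ)).HasTemperateGrowth := by
    fun_prop
  have hm := hasTemperateGrowth_freeSymbol hκ.le hc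
  have h0 : (2 : ℝ) + 0 = 2 := add_zero 2
  rw [toTemperedDistribution_freeResolvent, ← h0,
    ← TemperedDistribution.memSobolev_besselPotential_iff, TemperedDistribution.besselPotential,
    TemperedDistribution.fourierMultiplierCLM_fourierMultiplierCLM_apply hm hg]
  refine hy.fourierMultiplierCLM_of_bounded (hm.mul hg) ⟨c⁻¹ + κ⁻¹, fun ξ => ?_⟩
  have hd : 0 < κ * ‖ξ‖ ^ 2 + c := by positivity
  rw [Pi.mul_apply, ← Complex.ofReal_mul, Complex.norm_real, Real.norm_eq_abs,
    div_self two_ne_zero, Real.rpow_one, freeSymbol, abs_of_nonneg (by positivity),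
    inv_mul_eq_div, div_le_iff₀ hd]
  have e : (c⁻¹ + κ⁻¹) * (κ * ‖ξ‖ ^ 2 + c) = 1 + ‖ξ‖ ^ 2 + (c⁻¹ * κ * ‖ξ‖ ^ 2 + κ⁻¹ * c) := by
    field_simp; ring
  rw [e]
  have : 0 ≤ c⁻¹ * κ * ‖ξ‖ ^ 2 + κ⁻¹ * c := by positivity
  linarith

theorem isResolvent_freeResolvent {a c : ℝ} (ha : 0 < a) (hc : 0 < c) :
    IsResolvent ((-(a : ℂ)) • laplacianL2) (-(c : ℂ))
      (freeResolvent (κ := a * (2 * Real.pi) ^ 2) (by positivity) hc) := by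
  have hκ : 0 < a * (2 * Real.pi) ^ 2 := by positivity
  have hm := hasTemperateGrowth_freeSymbol hκ.le hc
  have hp : (fun ξ : R3 =>
      ((a * (2 * Real.pi) ^ 2 * ‖ξ‖ ^ 2 + c : ℝ) : ℂ)).HasTemperateGrowth := by
    fun_prop
  have hmp : ∀ ξ : R3, (freeSymbol (a * (2 * Real.pi) ^ 2) c ξ : ℂ) *
      ((a * (2 * Real.pi) ^ 2 * ‖ξ‖ ^ 2 + c : ℝ) : ℂ) = 1 := fun ξ => by
    rw [← Complex.ofReal_mul, freeSymbol, inv_mul_cancel₀ (by positivity), Complex.ofReal_one]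
  have key : ∀ x : laplacianL2.domain,
      ((((-(a : ℂ)) • laplacianL2) x - (-(c : ℂ)) • (x : L2) : L2) : 𝓢'(R3, ℂ)) =
        TemperedDistribution.fourierMultiplierCLM ℂ
          (fun ξ => ((a * (2 * Real.pi) ^ 2 * ‖ξ‖ ^ 2 + c : ℝ) : ℂ)) ((x : L2) : 𝓢'(R3, ℂ)) :=
    fun x => by
      rw [neg_smul (c : ℂ), sub_neg_eq_add, toTemperedDistribution_add, LinearPMap.smul_apply,
        toTemperedDistribution_smul, toTemperedDistribution_smul,
        toTemperedDistribution_laplacianL2, neg_smul_laplacian_add_smul]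
  refine ⟨fun x => ?_, fun y => ⟨⟨_, memSobolev_freeResolvent hκ hc y⟩, rfl, ?_⟩⟩
  · apply l2_toDistribution_injective
    rw [toTemperedDistribution_freeResolvent, key,
      fourierMultiplierCLM_eq_self_of_mul_eq_one hp hm fun ξ => (mul_comm _ _).trans (hmp ξ)]
  · apply l2_toDistribution_injective
    rw [key]
    change TemperedDistribution.fourierMultiplierCLM ℂ _ (freeResolvent hκ.le hc y : 𝓢'(R3, ℂ)) = _
    rw [toTemperedDistribution_freeResolvent,
      fourierMultiplierCLM_eq_self_of_mul_eq_one hm hp hmp]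

end FreeResolvent

/-- The Schrödinger operator has the resolvent `A = (H + C + 1)⁻¹`, and `0 ≤ A ≤ 1`. -/
theorem exists_isResolvent_schrodinger {hbar : ℝ} (hh : 0 < hbar) {V : R3 → ℝ} {C : ℝ}
    (hC : 0 ≤ C) (hV : AEStronglyMeasurable V volume) (hVC : ∀ x, |V x| ≤ C) :
    ∃ A : L2 →L[ℂ] L2, IsResolvent (schrodinger hbar V) (-((C + 1 : ℝ) : ℂ)) A ∧
      IsSelfAdjoint A ∧ ∀ y, ‖A y‖ ^ 2 ≤ (inner ℂ y (A y)).re := by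
  have hmem : MemLp (fun x => (V x : ℂ)) ⊤ (volume : Measure R3) :=
    memLp_top_ofReal hV hVC
  have hop : mulOp V = mulLp hmem := by rw [mulOp, dif_pos hmem]; rfl
  have hc : 0 < C + 1 := by linarith
  have ha : 0 < hbar ^ 2 / 2 := by positivity
  rw [schrodinger, hop]
  exact (isResolvent_freeResolvent ha hc).vadd hC (isSelfAdjoint_freeResolvent _ hc)
    (mul_norm_freeResolvent_sq_le _ hc) (isSelfAdjoint_mulLp hmem)
    (norm_mulLp_le hmem hC (ae_of_all _ fun x => by simpa using hVC x))

/-! ### Plancherel's identity on `L¹ ∩ L²` -/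

section Plancherel

open FourierTransform

theorem eLpNorm_two_sq {X E : Type*} [MeasurableSpace X] [NormedAddCommGroup E] (μ : Measure X)
    (f : X → E) : eLpNorm f 2 μ ^ 2 = ∫⁻ x, ‖f x‖ₑ ^ 2 ∂μ := by
  rw [eLpNorm_eq_lintegral_rpow_enorm_toReal two_ne_zero ENNReal.ofNat_ne_top,
    ← ENNReal.rpow_natCast, ← ENNReal.rpow_mul]
  simp

/-- The Fourier integral of a function in `L¹ ∩ L²` represents its `L²` Fourier transform. -/
theorem fourier_toLp_ae_eq {F : R3 → ℂ} (h1 : Integrable F) (h2 : MemLp F 2) :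
    (𝓕 (h2.toLp F) : L2) =ᵐ[volume] 𝓕 F := by
  -- Both sides represent the distributional Fourier transform: they are tested against smooth
  -- compactly supported functions.
  have hcont : Continuous (𝓕 F) :=
    VectorFourier.fourierIntegral_continuous Real.continuous_fourierChar continuous_inner h1
  refine ae_eq_of_integral_contDiff_smul_eq ((Lp.memLp _).locallyIntegrable (by norm_num))
    hcont.locallyIntegrable fun g hg hgc => ?_
  have hg₁ : HasCompactSupport (Complex.ofRealCLM ∘ g) := hgc.comp_left rfl
  have hg₂ : ContDiff ℝ ((⊤ : ℕ∞) : WithTop ℕ∞) (Complex.ofRealCLM ∘ g) := by fun_prop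
  set G : 𝓢(R3, ℂ) := hg₁.toSchwartzMap hg₂ with hG
  have hGx : ∀ x, G x = (g x : ℂ) := fun x => rfl
  have e1 : ∫ x, g x • (𝓕 (h2.toLp F) : L2) x =
      ((𝓕 (h2.toLp F) : L2) : 𝓢'(R3, ℂ)) G := by
    rw [Lp.toTemperedDistribution_apply]
    rfl
  have e2 : ∫ x, g x • 𝓕 F x = ∫ x, G x • 𝓕 F x := rfl
  rw [e1, e2, ← Lp.fourier_toTemperedDistribution_eq, TemperedDistribution.fourier_apply,
    Lp.toTemperedDistribution_apply]
  have e3 : ∫ x, (𝓕 G) x • (h2.toLp F) x = ∫ x, (𝓕 G) x • F x := by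
    refine integral_congr_ae ?_
    filter_upwards [h2.coeFn_toLp] with x hx
    rw [hx]
  rw [e3]
  simpa using! VectorFourier.integral_fourierIntegral_smul_eq_flip (L := innerₗ R3)
    Real.continuous_fourierChar continuous_inner G.integrable h1

theorem lintegral_enorm_fourier_sq {F : R3 → ℂ} (h1 : Integrable F) (h2 : MemLp F 2) :
    ∫⁻ ξ, ‖𝓕 F ξ‖ₑ ^ 2 = ∫⁻ x, ‖F x‖ₑ ^ 2 := by
  rw [← eLpNorm_two_sq, ← eLpNorm_two_sq, ← eLpNorm_congr_ae (fourier_toLp_ae_eq h1 h2),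
    ← Lp.enorm_def, ← eLpNorm_congr_ae h2.coeFn_toLp, ← Lp.enorm_def, ← ofReal_norm,
    ← ofReal_norm, Lp.norm_fourier_eq]

theorem lintegral_comp_smul_R3 (f : R3 → ℝ≥0∞) {r : ℝ} (hr : 0 < r) :
    ∫⁻ x, f (r⁻¹ • x) = ENNReal.ofReal (r ^ 3) * ∫⁻ x, f x := by
  have hr' : r⁻¹ ≠ 0 := (inv_pos.2 hr).ne'
  have h := lintegral_map_equiv (μ := (volume : Measure R3)) f
    (Homeomorph.smulOfNeZero r⁻¹ hr').toMeasurableEquiv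
  change ∫⁻ x, f x ∂Measure.map (fun x : R3 => r⁻¹ • x) volume = ∫⁻ x, f (r⁻¹ • x) at h
  rw [Measure.map_addHaar_smul _ hr', lintegral_smul_measure] at h
  rw [← h, smul_eq_mul, finrank_euclideanSpace_fin, inv_pow, inv_inv,
    abs_of_pos (pow_pos hr 3)]

/-- Plancherel's identity for the semiclassical Fourier transform. -/
theorem lintegral_enorm_semiclassical_fourier_sq {hbar : ℝ} (hh : 0 < hbar) {F : R3 → ℂ}
    (h1 : Integrable F) (h2 : MemLp F 2) :
    ∫⁻ p : R3, ‖∫ x, Complex.exp (-(Complex.I * ((inner ℝ p x / hbar : ℝ) : ℂ))) * F x‖ₑ ^ 2 =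
      ENNReal.ofReal ((2 * Real.pi * hbar) ^ 3) * ∫⁻ x, ‖F x‖ₑ ^ 2 := by
  have hr : 0 < 2 * Real.pi * hbar := by positivity
  rw [← lintegral_enorm_fourier_sq h1 h2, ← lintegral_comp_smul_R3 _ hr]
  refine lintegral_congr fun p => ?_
  rw [Real.fourier_eq']
  congr 3
  ext x
  rw [smul_eq_mul]
  congr 2
  rw [inner_smul_right, real_inner_comm]
  push_cast
  field_simp

end Plancherel

/-! ### Windowed Fourier transforms -/

section WindowTransform

/-- The windowed Fourier transform
`(2 π hbar)^{-3/2} ∫ exp (-i p · x / hbar) w(q, x) ψ(x) dx` with window `w`. -/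
noncomputable def windowTransform (hbar : ℝ) (w : R3 → R3 → ℂ) (ψ : R3 → ℂ) (z : R3 × R3) : ℂ :=
  (((Real.sqrt ((2 * Real.pi * hbar) ^ 3))⁻¹ : ℝ) : ℂ) *
    ∫ x, Complex.exp (-(Complex.I * ((inner ℝ z.2 x / hbar : ℝ) : ℂ))) * (w z.1 x * ψ x)

theorem measurable_windowTransform (hbar : ℝ) {w : R3 → R3 → ℂ}
    (hw : Measurable (Function.uncurry w)) {ψ : R3 → ℂ} (hψ : Measurable ψ) :
    Measurable (windowTransform hbar w ψ) := by
  refine Measurable.const_mul ?_ _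
  refine (StronglyMeasurable.integral_prod_right' (f := fun y : (R3 × R3) × R3 =>
    Complex.exp (-(Complex.I * ((inner ℝ y.1.2 y.2 / hbar : ℝ) : ℂ))) *
      (w y.1.1 y.2 * ψ y.2)) ?_).measurable
  refine Measurable.stronglyMeasurable ?_
  have h1 : Measurable fun y : (R3 × R3) × R3 => w y.1.1 y.2 :=
    hw.comp ((measurable_fst.comp measurable_fst).prodMk measurable_snd)
  have h2 : Measurable fun y : (R3 × R3) × R3 => ψ y.2 := hψ.comp measurable_snd
  have h3 : Measurable fun y : (R3 × R3) × R3 =>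
      Complex.exp (-(Complex.I * ((inner ℝ y.1.2 y.2 / hbar : ℝ) : ℂ))) := by
    refine Continuous.measurable ?_
    fun_prop
  exact h3.mul (h1.mul h2)

/-- A window is admissible if it is measurable and has Gaussian decay. The rate is half of that of
the coherent states, which leaves room for polynomial factors. -/
structure IsWindow (hbar : ℝ) (w : R3 → R3 → ℂ) : Prop where
  measurable : Measurable (Function.uncurry w)
  bound : ∃ b, 0 ≤ b ∧ ∀ q x, ‖w q x‖ ≤ b * Real.exp (-(‖x - q‖ ^ 2 / (4 * hbar)))

theorem lintegral_exp_neg_sq {b : ℝ} (hb : 0 < b) :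
    ∫⁻ v : R3, ENNReal.ofReal (Real.exp (-b * ‖v‖ ^ 2)) =
      ENNReal.ofReal ((Real.pi / b) ^ (3 / 2 : ℝ)) := by
  have h := GaussianFourier.integral_rexp_neg_mul_sq_norm (V := R3) hb
  rw [finrank_euclideanSpace_fin] at h
  rw [← ofReal_integral_eq_lintegral_ofReal, h]
  · norm_num
  · refine Integrable.of_integral_ne_zero ?_
    rw [h]; positivity
  · exact ae_of_all _ fun v => (Real.exp_pos _).le

variable {hbar : ℝ} {w : R3 → R3 → ℂ}

theorem IsWindow.measurable_right (hw : IsWindow hbar w) (q : R3) : Measurable (w q) :=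
  hw.measurable.comp measurable_prodMk_left

theorem IsWindow.memLp_top (hh : 0 < hbar) (hw : IsWindow hbar w) (q : R3) :
    MemLp (w q) ⊤ := by
  obtain ⟨b, hb, h⟩ := hw.bound
  refine MeasureTheory.memLp_top_of_bound (hw.measurable_right q).aestronglyMeasurable b
    (ae_of_all _ fun x => (h q x).trans ?_)
  refine mul_le_of_le_one_right hb (Real.exp_le_one_iff.2 ?_)
  rw [neg_nonpos]; positivity

theorem lintegral_gaussian_translate {b : ℝ} (hb : 0 < b) (q : R3) :
    ∫⁻ x : R3, ENNReal.ofReal (Real.exp (-b * ‖x - q‖ ^ 2)) =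
      ENNReal.ofReal ((Real.pi / b) ^ (3 / 2 : ℝ)) := by
  rw [lintegral_sub_right_eq_self (fun x : R3 => ENNReal.ofReal (Real.exp (-b * ‖x‖ ^ 2))) q,
    lintegral_exp_neg_sq hb]

theorem enorm_sq_le_of_norm_le {a : ℂ} {b u : ℝ}
    (h : ‖a‖ ≤ b * Real.exp (-(u / (4 * hbar)))) :
    ‖a‖ₑ ^ 2 ≤ ENNReal.ofReal (b ^ 2) * ENNReal.ofReal (Real.exp (-(2 * hbar)⁻¹ * u)) := by
  rw [← ofReal_norm, ← ENNReal.ofReal_pow (norm_nonneg _), ← ENNReal.ofReal_mul (sq_nonneg _)]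
  refine ENNReal.ofReal_le_ofReal ((pow_le_pow_left₀ (norm_nonneg _) h 2).trans_eq ?_)
  rw [mul_pow, ← Real.exp_nat_mul]
  congr 2
  push_cast
  rcases eq_or_ne hbar 0 with rfl | h0
  · simp
  · field_simp; ring

theorem IsWindow.memLp_two (hh : 0 < hbar) (hw : IsWindow hbar w) (q : R3) :
    MemLp (w q) 2 := by
  obtain ⟨b, hb, h⟩ := hw.bound
  refine ⟨(hw.measurable_right q).aestronglyMeasurable, ?_⟩
  have h2 : eLpNorm (w q) 2 volume ^ 2 < ⊤ := by
    rw [eLpNorm_two_sq]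
    refine (lintegral_mono fun x => enorm_sq_le_of_norm_le (h q x)).trans_lt ?_
    rw [lintegral_const_mul' _ _ ENNReal.ofReal_ne_top,
      lintegral_gaussian_translate (by positivity)]
    exact ENNReal.mul_lt_top ENNReal.ofReal_lt_top ENNReal.ofReal_lt_top
  by_contra h3
  rw [not_lt_top_iff] at h3
  simp [h3] at h2

/-- By Fubini, the norm of a windowed Fourier transform is governed by the `L²` norm of the window in
its first variable. -/
theorem lintegral_window_left_le (hh : 0 < hbar) {b : ℝ}
    (h : ∀ q x, ‖w q x‖ ≤ b * Real.exp (-(‖x - q‖ ^ 2 / (4 * hbar)))) (x : R3) :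
    ∫⁻ q, ‖w q x‖ₑ ^ 2 ≤ ENNReal.ofReal (b ^ 2 * (2 * Real.pi * hbar) ^ (3 / 2 : ℝ)) := by
  refine (lintegral_mono fun q => enorm_sq_le_of_norm_le (h q x)).trans ?_
  rw [lintegral_const_mul' _ _ ENNReal.ofReal_ne_top, ENNReal.ofReal_mul (sq_nonneg b)]
  simp_rw [norm_sub_rev x]
  rw [lintegral_gaussian_translate (by positivity), div_inv_eq_mul]
  ring_nf
  rfl

theorem IsWindow.memLp_mul (hh : 0 < hbar) (hw : IsWindow hbar w) {ψ : R3 → ℂ} (hψ : MemLp ψ 2)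
    (q : R3) : MemLp (fun x => w q x * ψ x) 2 :=
  hψ.mul (p := ⊤) (q := 2) (r := 2) (hw.memLp_top hh q)

theorem IsWindow.integrable_mul (hh : 0 < hbar) (hw : IsWindow hbar w) {ψ : R3 → ℂ}
    (hψ : MemLp ψ 2) (q : R3) : Integrable (fun x => w q x * ψ x) :=
  (hw.memLp_two hh q).integrable_mul hψ

theorem IsWindow.integrable (hh : 0 < hbar) (hw : IsWindow hbar w) {ψ : R3 → ℂ}
    (hψ : MemLp ψ 2) (q p : R3) :
    Integrable fun x =>
      Complex.exp (-(Complex.I * ((inner ℝ p x / hbar : ℝ) : ℂ))) * (w q x * ψ x) := by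
  refine (hw.integrable_mul hh hψ q).bdd_mul (c := 1) ?_ (ae_of_all _ fun x => ?_)
  · refine Continuous.aestronglyMeasurable ?_
    fun_prop
  · rw [Complex.norm_exp]
    simp

/-- The `L²` norm of a windowed Fourier transform, by Plancherel's identity in the momentum. -/
theorem IsWindow.lintegral_windowTransform (hh : 0 < hbar) (hw : IsWindow hbar w) {ψ : R3 → ℂ}
    (hψm : Measurable ψ) (hψ : MemLp ψ 2) :
    ∫⁻ z, ‖windowTransform hbar w ψ z‖ₑ ^ 2 = ∫⁻ x, (∫⁻ q, ‖w q x‖ₑ ^ 2) * ‖ψ x‖ₑ ^ 2 := by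
  have hpos : 0 < (2 * Real.pi * hbar) ^ 3 := by positivity
  rw [Measure.volume_eq_prod, lintegral_prod _
    ((measurable_windowTransform hbar hw.measurable hψm).enorm.pow_const 2).aemeasurable]
  have hslice : ∀ q, ∫⁻ p, ‖windowTransform hbar w ψ (q, p)‖ₑ ^ 2 =
      ∫⁻ x, ‖w q x‖ₑ ^ 2 * ‖ψ x‖ₑ ^ 2 := fun q => by
    simp only [windowTransform, enorm_mul, mul_pow _ _ 2]
    rw [lintegral_const_mul' _ _ (by finiteness),
      lintegral_enorm_semiclassical_fourier_sq hh (hw.integrable_mul hh hψ q)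
        (hw.memLp_mul hh hψ q), ← mul_assoc]
    have e : ‖(((Real.sqrt ((2 * Real.pi * hbar) ^ 3))⁻¹ : ℝ) : ℂ)‖ₑ ^ 2 *
        ENNReal.ofReal ((2 * Real.pi * hbar) ^ 3) = 1 := by
      rw [← ofReal_norm, ← ENNReal.ofReal_pow (norm_nonneg _),
        ← ENNReal.ofReal_mul (sq_nonneg _), Complex.norm_real, Real.norm_eq_abs, sq_abs, inv_pow,
        Real.sq_sqrt hpos.le, inv_mul_cancel₀ hpos.ne', ENNReal.ofReal_one]
    rw [e, one_mul]
    simp only [enorm_mul, mul_pow _ _ 2]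
  simp_rw [hslice]
  rw [lintegral_lintegral_swap]
  · refine lintegral_congr fun x => ?_
    rw [lintegral_mul_const' _ _ (by finiteness)]
  · refine Measurable.aemeasurable ?_
    exact (hw.measurable.enorm.pow_const 2).mul
      ((hψm.comp measurable_snd).enorm.pow_const 2)

theorem IsWindow.eLpNorm_windowTransform_le (hh : 0 < hbar) (hw : IsWindow hbar w) {ψ : R3 → ℂ}
    (hψm : Measurable ψ) (hψ : MemLp ψ 2) {K : ℝ≥0∞} (hK : K ≠ ⊤)
    (h : ∀ x, ∫⁻ q, ‖w q x‖ₑ ^ 2 ≤ K ^ 2) :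
    eLpNorm (windowTransform hbar w ψ) 2 volume ≤ K * eLpNorm ψ 2 volume := by
  rw [← ENNReal.pow_le_pow_left_iff two_ne_zero, mul_pow, eLpNorm_two_sq, eLpNorm_two_sq,
    hw.lintegral_windowTransform hh hψm hψ, ← lintegral_const_mul' _ _ (by finiteness)]
  exact lintegral_mono fun x => by gcongr; exact h x

/-- A normalized window gives an isometry. -/
theorem IsWindow.eLpNorm_windowTransform_eq (hh : 0 < hbar) (hw : IsWindow hbar w) {ψ : R3 → ℂ}
    (hψm : Measurable ψ) (hψ : MemLp ψ 2) (h : ∀ x, ∫⁻ q, ‖w q x‖ₑ ^ 2 = 1) :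
    eLpNorm (windowTransform hbar w ψ) 2 volume = eLpNorm ψ 2 volume := by
  rw [← (ENNReal.pow_right_strictMono two_ne_zero).injective.eq_iff, eLpNorm_two_sq, eLpNorm_two_sq,
    hw.lintegral_windowTransform hh hψm hψ]
  simp_rw [h, one_mul]

end WindowTransform

/-! ### Gaussians and plane waves -/

section SchwartzGaussian

theorem one_add_norm_pow_mul_exp_le {b : ℝ} (hb : 0 < b) (q : R3) (K : ℕ) :
    ∃ M, ∀ x : R3, (1 + ‖x‖) ^ K * Real.exp (-b * ‖x - q‖ ^ 2) ≤ M := by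
  refine ⟨(1 + ‖q‖) ^ K * (K.factorial * Real.exp (1 + 1 / (4 * b))), fun x => ?_⟩
  set s := ‖x - q‖ with hs
  have hs0 : 0 ≤ s := norm_nonneg _
  have h1 : 1 + ‖x‖ ≤ (1 + ‖q‖) * (1 + s) := by
    have : ‖x‖ ≤ s + ‖q‖ := by
      calc ‖x‖ = ‖(x - q) + q‖ := by rw [sub_add_cancel]
        _ ≤ _ := norm_add_le _ _
    nlinarith [norm_nonneg q]
  have h2 : (1 + s) ^ K ≤ K.factorial * Real.exp (1 + s) := by
    have := Real.pow_div_factorial_le_exp (1 + s) (by positivity) K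
    rwa [div_le_iff₀' (by positivity)] at this
  have h3 : Real.exp (1 + s) * Real.exp (-b * s ^ 2) ≤ Real.exp (1 + 1 / (4 * b)) := by
    rw [← Real.exp_add]
    refine Real.exp_le_exp.2 ?_
    have h4 : 1 / (4 * b) - (s - b * s ^ 2) = b * (s - 1 / (2 * b)) ^ 2 := by
      field_simp; ring
    have h5 : 0 ≤ b * (s - 1 / (2 * b)) ^ 2 := by positivity
    linarith
  calc (1 + ‖x‖) ^ K * Real.exp (-b * s ^ 2)
      ≤ ((1 + ‖q‖) * (1 + s)) ^ K * Real.exp (-b * s ^ 2) := by gcongr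
    _ = (1 + ‖q‖) ^ K * ((1 + s) ^ K * Real.exp (-b * s ^ 2)) := by rw [mul_pow]; ring
    _ ≤ (1 + ‖q‖) ^ K * (K.factorial * Real.exp (1 + s) * Real.exp (-b * s ^ 2)) := by gcongr
    _ = (1 + ‖q‖) ^ K * (K.factorial * (Real.exp (1 + s) * Real.exp (-b * s ^ 2))) := by ring
    _ ≤ _ := by gcongr

theorem hasTemperateGrowth_neg_mul_norm_sub_sq (b : ℝ) (q : R3) :
    (fun x : R3 => -b * ‖x - q‖ ^ 2).HasTemperateGrowth :=
  (Function.HasTemperateGrowth.const (-b)).mul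
    ((Function.hasTemperateGrowth_norm_sq R3).comp
      (Function.HasTemperateGrowth.id'.sub (Function.HasTemperateGrowth.const q)))

/-- The Gaussian `exp (-b |x - q|²)` as a Schwartz function. -/
noncomputable def schwartzGaussian {b : ℝ} (hb : 0 < b) (q : R3) : 𝓢(R3, ℝ) where
  toFun x := Real.exp (-b * ‖x - q‖ ^ 2)
  smooth' := (hasTemperateGrowth_neg_mul_norm_sub_sq b q).1.exp
  decay' k n := by
    have hP := hasTemperateGrowth_neg_mul_norm_sub_sq b q
    -- By Faà di Bruno, the derivatives of the Gaussian are bounded by polynomials times it.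
    obtain ⟨m, C, hC, hb'⟩ := hP.norm_iteratedFDeriv_le_uniform n
    obtain ⟨M, hM⟩ := one_add_norm_pow_mul_exp_le hb q (k + m * n)
    refine ⟨n.factorial * (C + 1) ^ n * M, fun x => ?_⟩
    have h1x : 1 ≤ 1 + ‖x‖ := by linarith [norm_nonneg x]
    have hD : 1 ≤ (C + 1) * (1 + ‖x‖) ^ m :=
      one_le_mul_of_one_le_of_one_le (by linarith) (one_le_pow₀ h1x)
    have h := norm_iteratedFDeriv_comp_le (𝕜 := ℝ) (g := Real.exp)
      (f := fun x : R3 => -b * ‖x - q‖ ^ 2) (n := n) (N := n) Real.contDiff_exp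
      (hP.1.of_le (by exact_mod_cast le_top)) le_rfl x
      (C := Real.exp (-b * ‖x - q‖ ^ 2)) (D := (C + 1) * (1 + ‖x‖) ^ m)
      (fun i _ => by
        rw [norm_iteratedFDeriv_eq_norm_iteratedDeriv, iteratedDeriv_eq_iterate,
          Real.iter_deriv_exp, Real.norm_eq_abs, Real.abs_exp])
      (fun i hi hin => by
        refine (hb' i hin x).trans (le_trans ?_ (le_self_pow₀ hD (by omega)))
        gcongr
        linarith)
    calc ‖x‖ ^ k * ‖iteratedFDeriv ℝ n (fun x : R3 => Real.exp (-b * ‖x - q‖ ^ 2)) x‖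
        ≤ (1 + ‖x‖) ^ k * (n.factorial * Real.exp (-b * ‖x - q‖ ^ 2) *
          ((C + 1) * (1 + ‖x‖) ^ m) ^ n) := by
          gcongr
          · linarith
          · exact h
      _ = n.factorial * (C + 1) ^ n *
          ((1 + ‖x‖) ^ (k + m * n) * Real.exp (-b * ‖x - q‖ ^ 2)) := by
          rw [mul_pow, ← pow_mul, pow_add]; ring
      _ ≤ _ := by gcongr; exact hM x

theorem iteratedDeriv_cexp_neg_I_mul (n : ℕ) :
    iteratedDeriv n (fun t : ℝ => Complex.exp (-(Complex.I * (t : ℂ)))) =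
      fun t : ℝ => (-Complex.I) ^ n * Complex.exp (-(Complex.I * (t : ℂ))) := by
  induction n with
  | zero => simp
  | succ n ih =>
    rw [iteratedDeriv_succ, ih]
    ext t
    have h1 : HasDerivAt (fun t : ℝ => -(Complex.I * (t : ℂ))) (-Complex.I) t := by
      simpa using! ((Complex.ofRealCLM.hasDerivAt (x := t)).const_mul Complex.I).neg
    rw [(h1.cexp.const_mul ((-Complex.I) ^ n)).deriv]
    ring

theorem hasTemperateGrowth_cexp_neg_I_mul :
    (fun t : ℝ => Complex.exp (-(Complex.I * (t : ℂ)))).HasTemperateGrowth := by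
  refine ⟨?_, fun n => ⟨0, 1, fun t => ?_⟩⟩
  · exact ((contDiff_const.mul Complex.ofRealCLM.contDiff).neg).cexp
  · rw [norm_iteratedFDeriv_eq_norm_iteratedDeriv, iteratedDeriv_cexp_neg_I_mul, norm_mul,
      norm_pow, Complex.norm_exp]
    simp

theorem hasTemperateGrowth_planeWave (hbar : ℝ) (p : R3) :
    (fun x : R3 =>
      Complex.exp (-(Complex.I * ((inner ℝ p x / hbar : ℝ) : ℂ)))).HasTemperateGrowth := by
  refine hasTemperateGrowth_cexp_neg_I_mul.comp (f := fun x : R3 => inner ℝ p x / hbar) ?_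
  simp_rw [div_eq_mul_inv]
  fun_prop

end SchwartzGaussian

/-! ### Coherent states and their Laplacian -/

section CoherentStates

/-- The Gaussian window `(π hbar)^{-3/4} exp (-|x - q|² / (2 hbar))` of the coherent states. -/
noncomputable def coherentWindow (hbar : ℝ) (q x : R3) : ℂ :=
  (((Real.pi * hbar) ^ (-(3 / 4) : ℝ) * Real.exp (-(‖x - q‖ ^ 2 / (2 * hbar))) : ℝ) : ℂ)

theorem conj_coherentState (hbar : ℝ) (q p x : R3) :
    (starRingEnd ℂ) (coherentState hbar q p x) =
      Complex.exp (-(Complex.I * ((inner ℝ p x / hbar : ℝ) : ℂ))) * coherentWindow hbar q x := by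
  rw [coherentState, coherentWindow, map_mul, map_mul, Complex.conj_ofReal, ← Complex.ofReal_exp,
    Complex.conj_ofReal, ← Complex.exp_conj, map_mul, Complex.conj_ofReal, Complex.conj_I]
  push_cast
  ring_nf

theorem coherentCoeff_eq {hbar : ℝ} (hh : 0 < hbar) (q p : R3) (ψ : L2) :
    coherentCoeff hbar q p ψ = ((Real.sqrt ((2 * Real.pi * hbar) ^ 3) : ℝ) : ℂ) *
      windowTransform hbar (coherentWindow hbar) ψ (q, p) := by
  have h : Real.sqrt ((2 * Real.pi * hbar) ^ 3) ≠ 0 := by positivity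
  rw [windowTransform, ← mul_assoc, ← Complex.ofReal_mul, mul_inv_cancel₀ h, Complex.ofReal_one,
    one_mul, coherentCoeff]
  simp_rw [conj_coherentState, mul_assoc]

/-- The conjugate `exp (-i p · x / hbar) exp (-|x - q|² / (2 hbar))` of an unnormalized coherent
state as a Schwartz function. -/
noncomputable def schwartzCoherent {hbar : ℝ} (hh : 0 < hbar) (q p : R3) : 𝓢(R3, ℂ) :=
  SchwartzMap.smulLeftCLM ℂ
    (fun x : R3 => Complex.exp (-(Complex.I * ((inner ℝ p x / hbar : ℝ) : ℂ))))
    (SchwartzMap.postcompCLM Complex.ofRealCLM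
      (schwartzGaussian (b := (2 * hbar)⁻¹) (by positivity) q))

theorem schwartzCoherent_apply {hbar : ℝ} (hh : 0 < hbar) (q p x : R3) :
    schwartzCoherent hh q p x = Complex.exp (-(Complex.I * ((inner ℝ p x / hbar : ℝ) : ℂ))) *
      ((Real.exp (-(‖x - q‖ ^ 2 / (2 * hbar))) : ℝ) : ℂ) := by
  rw [schwartzCoherent, SchwartzMap.smulLeftCLM_apply_apply (hasTemperateGrowth_planeWave hbar p),
    smul_eq_mul]
  congr 1
  change ((Real.exp (-(2 * hbar)⁻¹ * ‖x - q‖ ^ 2) : ℝ) : ℂ) = _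
  congr 3
  ring

/-- The logarithmic derivative of the conjugate coherent state in the direction `m`. -/
noncomputable def coherentLogDeriv (hbar : ℝ) (q p m x : R3) : ℂ :=
  -(((inner ℝ (x - q) m : ℝ) : ℂ) + Complex.I * ((inner ℝ p m : ℝ) : ℂ)) / hbar

/-- The restriction of a coherent state to a line is again a Gaussian. -/
theorem schwartzCoherent_line {hbar : ℝ} (hh : 0 < hbar) (q p m x : R3) (t : ℝ) :
    schwartzCoherent hh q p (x + t • m) = schwartzCoherent hh q p x *
      Complex.exp (t * coherentLogDeriv hbar q p m x - t ^ 2 * (‖m‖ ^ 2 / (2 * hbar))) := by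
  have hh' : (hbar : ℂ) ≠ 0 := by exact_mod_cast hh.ne'
  rw [schwartzCoherent_apply, schwartzCoherent_apply, Complex.ofReal_exp, Complex.ofReal_exp,
    ← Complex.exp_add, ← Complex.exp_add, ← Complex.exp_add]
  congr 1
  have e : x + t • m - q = (x - q) + t • m := by abel
  rw [e, norm_add_sq_real, inner_add_right, inner_smul_right, inner_smul_right, norm_smul,
    mul_pow, Real.norm_eq_abs, sq_abs, coherentLogDeriv]
  push_cast
  field_simp
  ring

theorem hasDerivAt_schwartzCoherent {hbar : ℝ} (hh : 0 < hbar) (q p m x : R3) :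
    HasDerivAt (fun t : ℝ => schwartzCoherent hh q p (x + t • m))
      (coherentLogDeriv hbar q p m x * schwartzCoherent hh q p x) 0 := by
  simp_rw [schwartzCoherent_line]
  have ht : HasDerivAt (fun t : ℝ => (t : ℂ)) 1 0 := Complex.ofRealCLM.hasDerivAt
  have h1 : HasDerivAt (fun t : ℝ => (t : ℂ) * coherentLogDeriv hbar q p m x -
      (t : ℂ) ^ 2 * ((‖m‖ : ℂ) ^ 2 / (2 * hbar))) (coherentLogDeriv hbar q p m x) 0 := by
    simpa using! (ht.mul_const (coherentLogDeriv hbar q p m x)).sub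
      ((ht.pow 2).mul_const ((‖m‖ : ℂ) ^ 2 / (2 * hbar)))
  have h2 := h1.cexp.const_mul (schwartzCoherent hh q p x)
  simpa [mul_comm] using h2

open LineDeriv

theorem lineDeriv_schwartzCoherent {hbar : ℝ} (hh : 0 < hbar) (q p m x : R3) :
    (∂_{m} (schwartzCoherent hh q p)) x =
      coherentLogDeriv hbar q p m x * schwartzCoherent hh q p x := by
  rw [SchwartzMap.lineDerivOp_apply]
  exact (hasDerivAt_schwartzCoherent hh q p m x).deriv

theorem lineDeriv_lineDeriv_schwartzCoherent {hbar : ℝ} (hh : 0 < hbar) (q p m x : R3) :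
    (∂_{m} (∂_{m} (schwartzCoherent hh q p))) x =
      (coherentLogDeriv hbar q p m x ^ 2 - ‖m‖ ^ 2 / hbar) * schwartzCoherent hh q p x := by
  rw [SchwartzMap.lineDerivOp_apply]
  have hl : ∀ t : ℝ, coherentLogDeriv hbar q p m (x + t • m) =
      coherentLogDeriv hbar q p m x - t * (‖m‖ ^ 2 / hbar) := fun t => by
    have e : x + t • m - q = (x - q) + t • m := by abel
    rw [coherentLogDeriv, coherentLogDeriv, e, inner_add_left, real_inner_smul_left,
      real_inner_self_eq_norm_sq]
    push_cast
    ring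
  have h : HasDerivAt (fun t : ℝ => (∂_{m} (schwartzCoherent hh q p)) (x + t • m))
      ((coherentLogDeriv hbar q p m x ^ 2 - ‖m‖ ^ 2 / hbar) * schwartzCoherent hh q p x) 0 := by
    simp_rw [lineDeriv_schwartzCoherent, hl]
    have ht : HasDerivAt (fun t : ℝ => (t : ℂ)) 1 0 := Complex.ofRealCLM.hasDerivAt
    have h1 := ((ht.mul_const ((‖m‖ : ℂ) ^ 2 / hbar)).const_sub
      (coherentLogDeriv hbar q p m x)).mul (hasDerivAt_schwartzCoherent hh q p m x)
    refine h1.congr_deriv ?_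
    simp
    ring
  exact h.deriv

theorem laplacian_schwartzCoherent {hbar : ℝ} (hh : 0 < hbar) (q p x : R3) :
    (Δ (schwartzCoherent hh q p)) x =
      (((‖x - q‖ ^ 2 - ‖p‖ ^ 2 : ℝ) : ℂ) / hbar ^ 2 - 3 / hbar +
        2 * Complex.I / hbar ^ 2 * ∑ j, (p j : ℂ) * ((x - q) j : ℂ)) *
          schwartzCoherent hh q p x := by
  have hh' : (hbar : ℂ) ≠ 0 := by exact_mod_cast hh.ne'
  rw [SchwartzMap.laplacian_eq_sum (EuclideanSpace.basisFun (Fin 3) ℝ), sum_apply]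
  simp_rw [lineDeriv_lineDeriv_schwartzCoherent, ← Finset.sum_mul]
  congr 1
  have h1 : ∀ (u : R3) (j : Fin 3), inner ℝ u (EuclideanSpace.basisFun (Fin 3) ℝ j) = u j :=
    fun u j => by simp [EuclideanSpace.inner_single_right]
  simp_rw [coherentLogDeriv, h1, OrthonormalBasis.norm_eq_one,
    EuclideanSpace.real_norm_sq_eq, Fin.sum_univ_three]
  push_cast
  field_simp
  ring_nf
  simp only [Complex.I_sq]
  ring

/-- Pairing the distributional Laplacian with a coherent state. -/
theorem integral_schwartzCoherent_mul_laplacianL2 {hbar : ℝ} (hh : 0 < hbar) (q p : R3)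
    (ψ : laplacianL2.domain) :
    ∫ x, schwartzCoherent hh q p x * laplacianL2 ψ x =
      ∫ x, (Δ (schwartzCoherent hh q p)) x * (ψ : L2) x := by
  have h := congrArg (fun T : 𝓢'(R3, ℂ) => T (schwartzCoherent hh q p))
    (toTemperedDistribution_laplacianL2 ψ)
  simp only [TemperedDistribution.laplacian_apply_apply, Lp.toTemperedDistribution_apply,
    smul_eq_mul] at h
  exact h

end CoherentStates

/-! ### Linearity of the windowed Fourier transform -/

section WindowLinearity

variable {hbar : ℝ} {w : R3 → R3 → ℂ}

theorem windowTransform_congr_ae {ψ χ : R3 → ℂ} (h : ψ =ᵐ[volume] χ) :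
    windowTransform hbar w ψ = windowTransform hbar w χ := by
  ext z
  rw [windowTransform, windowTransform]
  congr 1
  refine integral_congr_ae ?_
  filter_upwards [h] with x hx
  rw [hx]

theorem IsWindow.windowTransform_add (hh : 0 < hbar) (hw : IsWindow hbar w) {ψ χ : R3 → ℂ}
    (hψ : MemLp ψ 2) (hχ : MemLp χ 2) (z : R3 × R3) :
    windowTransform hbar w (fun x => ψ x + χ x) z =
      windowTransform hbar w ψ z + windowTransform hbar w χ z := by
  simp only [windowTransform]
  rw [← mul_add, ← integral_add (hw.integrable hh hψ _ _) (hw.integrable hh hχ _ _)]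
  congr 2
  ext x
  ring

theorem windowTransform_const_mul (c : ℂ) (ψ : R3 → ℂ) (z : R3 × R3) :
    windowTransform hbar w (fun x => c * ψ x) z = c * windowTransform hbar w ψ z := by
  simp only [windowTransform]
  rw [mul_left_comm c]
  congr 1
  rw [← integral_const_mul]
  congr 1
  ext x
  ring

theorem measurable_coe_L2 (ψ : L2) : Measurable ψ := (Lp.stronglyMeasurable ψ).measurable

theorem IsWindow.memLp_windowTransform (hh : 0 < hbar) (hw : IsWindow hbar w) (ψ : L2) :
    MemLp (windowTransform hbar w ψ) 2 := by
  refine ⟨(measurable_windowTransform hbar hw.measurable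
    (measurable_coe_L2 ψ)).aestronglyMeasurable, ?_⟩
  obtain ⟨b, hb, h⟩ := hw.bound
  set K2 : ℝ≥0∞ := ENNReal.ofReal (Real.sqrt (b ^ 2 * (2 * Real.pi * hbar) ^ (3 / 2 : ℝ))) with hK2
  refine (hw.eLpNorm_windowTransform_le hh (measurable_coe_L2 ψ) (Lp.memLp ψ) (K := K2)
    ENNReal.ofReal_ne_top fun x => ?_).trans_lt ?_
  · rw [hK2, ← ENNReal.ofReal_pow (Real.sqrt_nonneg _), Real.sq_sqrt (by positivity)]
    exact lintegral_window_left_le hh h x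
  · exact ENNReal.mul_lt_top ENNReal.ofReal_lt_top (Lp.memLp ψ).2

end WindowLinearity

/-! ### The coherent state transform -/

section CoherentTransform

/-- The Hilbert space `L²(ℝ⁶; ℂ)` over the phase space. -/
abbrev PhaseL2 : Type := Lp ℂ 2 (volume : Measure (R3 × R3))

theorem measurable_coherentWindow (hbar : ℝ) :
    Measurable (Function.uncurry (coherentWindow hbar)) := by
  unfold coherentWindow Function.uncurry
  refine Complex.measurable_ofReal.comp ?_
  fun_prop

theorem norm_coherentWindow (hbar : ℝ) (hh : 0 < hbar) (q x : R3) :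
    ‖coherentWindow hbar q x‖ =
      (Real.pi * hbar) ^ (-(3 / 4) : ℝ) * Real.exp (-(‖x - q‖ ^ 2 / (2 * hbar))) := by
  rw [coherentWindow, Complex.norm_real, Real.norm_eq_abs, abs_of_nonneg]
  positivity

/-- The polynomial factor is absorbed into half of the Gaussian decay. -/
theorem norm_coherentWindow_mul_le {hbar : ℝ} (hh : 0 < hbar) {k : R3 → R3 → ℂ} {a : ℝ}
    (ha : 0 ≤ a) (hk : ∀ q x, ‖k q x‖ ≤ a * (1 + ‖x - q‖ ^ 2 / hbar)) (q x : R3) :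
    ‖coherentWindow hbar q x * k q x‖ ≤
      ((Real.pi * hbar) ^ (-(3 / 4) : ℝ) * (4 * a)) * Real.exp (-(‖x - q‖ ^ 2 / (4 * hbar))) := by
  rw [norm_mul, norm_coherentWindow hbar hh, mul_assoc, mul_assoc]
  refine mul_le_mul_of_nonneg_left ?_ (by positivity)
  set u := ‖x - q‖ ^ 2 / (4 * hbar) with hu
  have hu0 : 0 ≤ u := by positivity
  have e1 : ‖x - q‖ ^ 2 / (2 * hbar) = 2 * u := by rw [hu]; field_simp; norm_num
  have e2 : ‖x - q‖ ^ 2 / hbar = 4 * u := by rw [hu]; field_simp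
  have h1 := hk q x
  rw [e2] at h1
  have h2 : 1 + 4 * u ≤ 4 * Real.exp u := by linarith [Real.add_one_le_exp u]
  calc Real.exp (-(‖x - q‖ ^ 2 / (2 * hbar))) * ‖k q x‖
      ≤ Real.exp (-(2 * u)) * (a * (4 * Real.exp u)) := by
        rw [e1]; gcongr; exact h1.trans (by gcongr)
    _ = 4 * a * (Real.exp (-(2 * u)) * Real.exp u) := by ring
    _ = 4 * a * Real.exp (-u) := by rw [← Real.exp_add]; ring_nf

theorem isWindow_coherentWindow_mul {hbar : ℝ} (hh : 0 < hbar) {k : R3 → R3 → ℂ}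
    (hkm : Measurable (Function.uncurry k)) {a : ℝ}
    (ha : 0 ≤ a) (hk : ∀ q x, ‖k q x‖ ≤ a * (1 + ‖x - q‖ ^ 2 / hbar)) :
    IsWindow hbar (fun q x => coherentWindow hbar q x * k q x) :=
  ⟨(measurable_coherentWindow hbar).mul hkm, _, by positivity,
    norm_coherentWindow_mul_le hh ha hk⟩

theorem isWindow_coherentWindow {hbar : ℝ} (hh : 0 < hbar) :
    IsWindow hbar (coherentWindow hbar) := by
  have h := isWindow_coherentWindow_mul hh (k := fun _ _ => 1) measurable_const zero_le_one
    (fun q x => by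
      rw [norm_one, one_mul]
      have : 0 ≤ ‖x - q‖ ^ 2 / hbar := by positivity
      linarith)
  simpa using h

/-- The normalization of the coherent states. -/
theorem lintegral_coherentWindow {hbar : ℝ} (hh : 0 < hbar) (x : R3) :
    ∫⁻ q, ‖coherentWindow hbar q x‖ₑ ^ 2 = 1 := by
  have e : ∀ q, ‖coherentWindow hbar q x‖ₑ ^ 2 =
      ENNReal.ofReal ((Real.pi * hbar) ^ (-(3 / 2) : ℝ)) *
        ENNReal.ofReal (Real.exp (-hbar⁻¹ * ‖q - x‖ ^ 2)) := fun q => by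
    rw [← ofReal_norm, norm_coherentWindow hbar hh, ← ENNReal.ofReal_pow (by positivity),
      ← ENNReal.ofReal_mul (by positivity), mul_pow, ← Real.exp_nat_mul, ← Real.rpow_mul_natCast
      (by positivity), norm_sub_rev]
    congr 3
    · norm_num
    · push_cast; field_simp
  simp_rw [e]
  rw [lintegral_const_mul' _ _ ENNReal.ofReal_ne_top,
    lintegral_gaussian_translate (by positivity), div_inv_eq_mul,
    ← ENNReal.ofReal_mul (by positivity), ← Real.rpow_add (by positivity)]
  norm_num

/-- The map `ψ ↦ (2 π hbar)^{-3/2} ⟨φ_{(q,p)} | ψ⟩` from `L²(ℝ³)` to `L²(ℝ⁶)`. -/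
noncomputable def coherentTransform {hbar : ℝ} (hh : 0 < hbar) : L2 →L[ℂ] PhaseL2 :=
  LinearMap.mkContinuous
    { toFun := fun ψ => ((isWindow_coherentWindow hh).memLp_windowTransform hh ψ).toLp _
      map_add' := fun ψ χ => by
        rw [← MemLp.toLp_add]
        congr 1
        ext z
        rw [windowTransform_congr_ae (Lp.coeFn_add ψ χ)]
        exact (isWindow_coherentWindow hh).windowTransform_add hh (Lp.memLp ψ) (Lp.memLp χ) z
      map_smul' := fun c ψ => by
        rw [RingHom.id_apply, ← MemLp.toLp_const_smul]
        congr 1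
        ext z
        rw [windowTransform_congr_ae (Lp.coeFn_smul c ψ)]
        exact windowTransform_const_mul c _ z } 1 fun ψ => by
    have h := (isWindow_coherentWindow hh).eLpNorm_windowTransform_eq hh (measurable_coe_L2 ψ)
      (Lp.memLp ψ) (lintegral_coherentWindow hh)
    rw [one_mul]
    change ‖((isWindow_coherentWindow hh).memLp_windowTransform hh ψ).toLp _‖ ≤ _
    rw [Lp.norm_toLp, h, Lp.norm_def]

theorem coherentTransform_ae {hbar : ℝ} (hh : 0 < hbar) (ψ : L2) :
    coherentTransform hh ψ =ᵐ[volume] windowTransform hbar (coherentWindow hbar) ψ :=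
  ((isWindow_coherentWindow hh).memLp_windowTransform hh ψ).coeFn_toLp

theorem norm_coherentTransform_le {hbar : ℝ} (hh : 0 < hbar) : ‖coherentTransform hh‖ ≤ 1 :=
  LinearMap.mkContinuous_norm_le _ zero_le_one _

/-- A factor of size `a (1 + |x - q|² / ħ)` in the window costs a factor `8 a` in the norm, uniformly
in `ħ`. -/
theorem norm_toLp_windowTransform_le {hbar : ℝ} (hh : 0 < hbar) {k : R3 → R3 → ℂ}
    (hkm : Measurable (Function.uncurry k)) {a : ℝ}
    (ha : 0 ≤ a) (hk : ∀ q x, ‖k q x‖ ≤ a * (1 + ‖x - q‖ ^ 2 / hbar)) (ψ : L2) :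
    ‖((isWindow_coherentWindow_mul hh hkm ha hk).memLp_windowTransform hh ψ).toLp _‖ ≤
      8 * a * ‖ψ‖ := by
  have hw := isWindow_coherentWindow_mul hh hkm ha hk
  have h := hw.eLpNorm_windowTransform_le hh (measurable_coe_L2 ψ) (Lp.memLp ψ)
    (K := ENNReal.ofReal (8 * a)) ENNReal.ofReal_ne_top fun x => by
      rw [← ENNReal.ofReal_pow (by positivity)]
      refine (lintegral_window_left_le hh (norm_coherentWindow_mul_le hh ha hk) x).trans
        (ENNReal.ofReal_le_ofReal ?_)
      have e1 : ((Real.pi * hbar) ^ (-(3 / 4) : ℝ)) ^ 2 * (Real.pi * hbar) ^ (3 / 2 : ℝ) = 1 := by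
        rw [← Real.rpow_mul_natCast (by positivity), ← Real.rpow_add (by positivity)]
        norm_num
      have e2 : (2 : ℝ) ^ (3 / 2 : ℝ) ≤ 4 := by
        calc (2 : ℝ) ^ (3 / 2 : ℝ) ≤ 2 ^ (2 : ℝ) :=
              Real.rpow_le_rpow_of_exponent_le one_le_two (by norm_num)
          _ = 4 := by norm_num
      rw [mul_assoc 2, Real.mul_rpow zero_le_two (by positivity), mul_pow]
      calc _ = ((Real.pi * hbar) ^ (-(3 / 4) : ℝ)) ^ 2 * (Real.pi * hbar) ^ (3 / 2 : ℝ) *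
            ((4 * a) ^ 2 * 2 ^ (3 / 2 : ℝ)) := by ring
        _ ≤ 1 * ((4 * a) ^ 2 * 4) := by rw [e1]; gcongr
        _ = (8 * a) ^ 2 := by ring
  rw [Lp.norm_toLp, Lp.norm_def]
  refine (ENNReal.toReal_mono (ENNReal.mul_ne_top ENNReal.ofReal_ne_top (Lp.eLpNorm_ne_top ψ))
    h).trans_eq ?_
  rw [ENNReal.toReal_mul, ENNReal.toReal_ofReal (by positivity)]

end CoherentTransform

/-! ### The intertwining defect of the Hamiltonians -/

section Intertwining

/-- The classical Hamiltonian `|p|² / 2 + V(q)` on the phase space. -/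
noncomputable def hamiltonian (V : R3 → ℝ) (z : R3 × R3) : ℝ := ‖z.2‖ ^ 2 / 2 + V z.1

/-- The factor of the window of `W H - h W` that does not involve the momentum. -/
noncomputable def potentialDefect (hbar : ℝ) (V : R3 → ℝ) (q x : R3) : ℂ :=
  ((V x - V q + 3 * hbar / 2 - ‖x - q‖ ^ 2 / 2 : ℝ) : ℂ)

/-- The factor of the window of `W H - h W` in front of the momentum component `p_j`, up to `-i`. -/
noncomputable def coordDefect (j : Fin 3) (q x : R3) : ℂ := ((x - q) j : ℂ)

theorem measurable_potentialDefect (hbar : ℝ) {V : R3 → ℝ} (hV : Measurable V) :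
    Measurable (Function.uncurry (potentialDefect hbar V)) := by
  unfold potentialDefect Function.uncurry
  refine Complex.measurable_ofReal.comp ?_
  have h1 : Measurable fun z : R3 × R3 => V z.2 := hV.comp measurable_snd
  have h2 : Measurable fun z : R3 × R3 => V z.1 := hV.comp measurable_fst
  fun_prop

theorem measurable_coordDefect (j : Fin 3) : Measurable (Function.uncurry (coordDefect j)) := by
  unfold coordDefect Function.uncurry
  refine Complex.measurable_ofReal.comp ?_
  fun_prop

/-- With `r = |x - q| / √ħ`, this is `r ≤ 1 + r²`. -/
theorem norm_coordDefect_le {hbar : ℝ} (hh : 0 < hbar) (j : Fin 3) (q x : R3) :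
    ‖coordDefect j q x‖ ≤ Real.sqrt hbar * (1 + ‖x - q‖ ^ 2 / hbar) := by
  have hs : 0 < Real.sqrt hbar := Real.sqrt_pos.2 hh
  have h1 : ‖coordDefect j q x‖ ≤ ‖x - q‖ := by
    rw [coordDefect, Complex.norm_real]
    exact PiLp.norm_apply_le (x - q) j
  have e : Real.sqrt hbar * (1 + ‖x - q‖ ^ 2 / hbar) =
      (hbar + ‖x - q‖ ^ 2) / Real.sqrt hbar := by
    rw [eq_div_iff hs.ne', mul_right_comm, Real.mul_self_sqrt hh.le]
    field_simp
  rw [e, le_div_iff₀ hs]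
  have h2 := Real.sq_sqrt hh.le
  nlinarith [sq_nonneg (‖x - q‖ - Real.sqrt hbar), norm_nonneg (x - q)]

/-- With `r = |x - q|² / ħ`, Hölder continuity bounds `V(x) - V(q)` by `C ħ^{1/10} r^{1/10}`. -/
theorem norm_potentialDefect_le {hbar : ℝ} (hh : 0 < hbar) {V : R3 → ℝ} {C : ℝ} (hC : 0 ≤ C)
    (hV : ∀ x y, |V x - V y| ≤ C * ‖x - y‖ ^ (1 / 5 : ℝ)) (q x : R3) :
    ‖potentialDefect hbar V q x‖ ≤
      (C * hbar ^ (1 / 10 : ℝ) + 2 * hbar) * (1 + ‖x - q‖ ^ 2 / hbar) := by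
  set r := ‖x - q‖ ^ 2 / hbar with hr
  have hr0 : 0 ≤ r := by positivity
  have e1 : ‖x - q‖ ^ 2 = hbar * r := by rw [hr]; field_simp
  have e2 : ‖x - q‖ ^ (1 / 5 : ℝ) = hbar ^ (1 / 10 : ℝ) * r ^ (1 / 10 : ℝ) := by
    rw [← Real.mul_rpow hh.le hr0, ← e1, ← Real.rpow_natCast, ← Real.rpow_mul (norm_nonneg _)]
    norm_num
  have h1 : r ^ (1 / 10 : ℝ) ≤ 1 + r := by
    calc r ^ (1 / 10 : ℝ) ≤ (1 + r) ^ (1 / 10 : ℝ) := by gcongr; linarith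
      _ ≤ (1 + r) ^ (1 : ℝ) :=
        Real.rpow_le_rpow_of_exponent_le (by linarith) (by norm_num)
      _ = 1 + r := Real.rpow_one _
  have h2 : |V x - V q| ≤ C * hbar ^ (1 / 10 : ℝ) * (1 + r) := by
    refine (hV x q).trans ?_
    rw [e2, mul_assoc]
    gcongr
  rw [potentialDefect, Complex.norm_real, Real.norm_eq_abs, e1]
  have h3 := abs_le.1 h2
  rw [abs_le]
  constructor <;> nlinarith [mul_nonneg hh.le hr0, h3.1, h3.2]

theorem integral_linear_combination {X : Type*} [MeasurableSpace X] {μ : Measure X}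
    {f₀ f₁ f₂ : X → ℂ} {g : Fin 3 → X → ℂ} (h₀ : Integrable f₀ μ) (h₁ : Integrable f₁ μ)
    (h₂ : Integrable f₂ μ) (hg : ∀ j, Integrable (g j) μ) {a b : ℂ} {c : Fin 3 → ℂ} :
    ∫ x, (a * f₀ x + f₁ x - f₂ x - b * ∑ j, c j * g j x) ∂μ =
      a * ∫ x, f₀ x ∂μ + ∫ x, f₁ x ∂μ - ∫ x, f₂ x ∂μ - b * ∑ j, c j * ∫ x, g j x ∂μ := by
  have hs : Integrable (fun x => ∑ j, c j * g j x) μ :=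
    integrable_finsetSum _ fun j _ => (hg j).const_mul _
  have h01 : Integrable (fun x => a * f₀ x + f₁ x) μ := (h₀.const_mul a).add h₁
  have h012 : Integrable (fun x => a * f₀ x + f₁ x - f₂ x) μ := h01.sub h₂
  rw [integral_sub h012 (hs.const_mul b), integral_sub h01 h₂, integral_add (h₀.const_mul a) h₁,
    integral_const_mul, integral_const_mul, integral_finsetSum _ fun j _ => (hg j).const_mul _]
  simp_rw [integral_const_mul]

/-- The intertwining defect on the domain: `W (H + c) ψ - (h + c) W ψ` is a sum of windowed Fourier
transforms of `ψ` with small windows. -/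
theorem windowTransform_schrodinger {hbar : ℝ} (hh : 0 < hbar) {V : R3 → ℝ} (hVm : Measurable V)
    {C : ℝ} (hC : 0 ≤ C) (hVC : ∀ x, |V x| ≤ C)
    (hV : ∀ x y, |V x - V y| ≤ C * ‖x - y‖ ^ (1 / 5 : ℝ)) (c : ℝ)
    (ψ : (schrodinger hbar V).domain) (z : R3 × R3) :
    windowTransform hbar (coherentWindow hbar)
        (schrodinger hbar V ψ - (-(c : ℂ)) • (ψ : L2) : L2) z =
      ((hamiltonian V z + c : ℝ) : ℂ) * windowTransform hbar (coherentWindow hbar) (ψ : L2) z +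
        windowTransform hbar (fun q x => coherentWindow hbar q x * potentialDefect hbar V q x)
          (ψ : L2) z -
        Complex.I * ∑ j, (z.2 j : ℂ) *
          windowTransform hbar (fun q x => coherentWindow hbar q x * coordDefect j q x)
            (ψ : L2) z := by
  obtain ⟨q, p⟩ := z
  have hmem : MemLp (fun x => (V x : ℂ)) ⊤ (volume : Measure R3) :=
    memLp_top_ofReal hVm.aestronglyMeasurable hVC
  have hhc : (hbar : ℂ) ≠ 0 := by exact_mod_cast hh.ne'
  set d : L2 := laplacianL2 ψ with hd
  set u : L2 := (ψ : L2) with hu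
  set γ : ℂ := (((Real.pi * hbar) ^ (-(3 / 4) : ℝ) : ℝ) : ℂ) with hγ
  set s : ℂ := (((Real.sqrt ((2 * Real.pi * hbar) ^ 3))⁻¹ : ℝ) : ℂ) with hs
  have happ : schrodinger hbar V ψ - (-(c : ℂ)) • u =
      mulOp V u + (((-((hbar ^ 2 / 2 : ℝ) : ℂ)) • d) + (c : ℂ) • u) := by
    change mulOp V u + (-((hbar ^ 2 / 2 : ℝ) : ℂ)) • d - (-(c : ℂ)) • u = _
    module
  have hwin := isWindow_coherentWindow hh
  have hw0 := isWindow_coherentWindow_mul hh (measurable_potentialDefect hbar hVm) (by positivity)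
    (norm_potentialDefect_le hh hC hV)
  have hwj := fun j => isWindow_coherentWindow_mul hh (measurable_coordDefect j)
    (Real.sqrt_nonneg hbar) (norm_coordDefect_le hh j)
  have i0 := hwin.integrable hh (Lp.memLp u) q p
  have iV := hwin.integrable hh (Lp.memLp (mulOp V u)) q p
  have i2 := hw0.integrable hh (Lp.memLp u) q p
  have ij := fun j => (hwj j).integrable hh (Lp.memLp u) q p
  have hΦ : ∀ x, Complex.exp (-(Complex.I * ((inner ℝ p x / hbar : ℝ) : ℂ))) *
      coherentWindow hbar q x = γ * schwartzCoherent hh q p x := fun x => by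
    rw [schwartzCoherent_apply, coherentWindow, Complex.ofReal_mul]; ring
  -- The integrals of `-ħ²/2 Δ` applied to the coherent state, evaluated by the explicit formula.
  have key : (-((hbar ^ 2 / 2 : ℝ) : ℂ)) *
      ∫ x, Complex.exp (-(Complex.I * ((inner ℝ p x / hbar : ℝ) : ℂ))) *
        (coherentWindow hbar q x * d x) =
      ((‖p‖ ^ 2 / 2 + V q : ℝ) : ℂ) *
        (∫ x, Complex.exp (-(Complex.I * ((inner ℝ p x / hbar : ℝ) : ℂ))) *
          (coherentWindow hbar q x * u x)) +
      (∫ x, Complex.exp (-(Complex.I * ((inner ℝ p x / hbar : ℝ) : ℂ))) *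
          ((coherentWindow hbar q x * potentialDefect hbar V q x) * u x)) -
      (∫ x, Complex.exp (-(Complex.I * ((inner ℝ p x / hbar : ℝ) : ℂ))) *
          (coherentWindow hbar q x * mulOp V u x)) -
      Complex.I * ∑ j, (p j : ℂ) *
        ∫ x, Complex.exp (-(Complex.I * ((inner ℝ p x / hbar : ℝ) : ℂ))) *
          ((coherentWindow hbar q x * coordDefect j q x) * u x) := by
    rw [← integral_linear_combination i0 i2 iV ij]
    have e1 : ∫ x, Complex.exp (-(Complex.I * ((inner ℝ p x / hbar : ℝ) : ℂ))) *
        (coherentWindow hbar q x * d x) =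
        ∫ x, γ * ((Δ (schwartzCoherent hh q p)) x * u x) := by
      have e0 : ∫ x, schwartzCoherent hh q p x * d x =
          ∫ x, (Δ (schwartzCoherent hh q p)) x * u x :=
        integral_schwartzCoherent_mul_laplacianL2 hh q p ψ
      rw [integral_const_mul, ← e0, ← integral_const_mul]
      refine integral_congr_ae (ae_of_all _ fun x => ?_)
      beta_reduce
      rw [← mul_assoc, hΦ, mul_assoc]
    rw [e1, ← integral_const_mul]
    refine integral_congr_ae ?_
    filter_upwards [mulOp_apply_ae hmem u] with x hx
    rw [hx, laplacian_schwartzCoherent]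
    have e2 : ∀ a : ℂ, Complex.exp (-(Complex.I * ((inner ℝ p x / hbar : ℝ) : ℂ))) *
        ((coherentWindow hbar q x * a) * u x) = γ * schwartzCoherent hh q p x * a * u x :=
      fun a => by rw [← hΦ]; ring
    have e3 : ∀ a : ℂ, Complex.exp (-(Complex.I * ((inner ℝ p x / hbar : ℝ) : ℂ))) *
        (coherentWindow hbar q x * a) = γ * schwartzCoherent hh q p x * a :=
      fun a => by rw [← hΦ]; ring
    simp_rw [e2, e3, potentialDefect, coordDefect, Fin.sum_univ_three]
    push_cast
    field_simp
    ring
  rw [happ, windowTransform_congr_ae (Lp.coeFn_add _ _)]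
  rw [show (⇑(mulOp V u) + ⇑((-((hbar ^ 2 / 2 : ℝ) : ℂ)) • d + (c : ℂ) • u)) =
    fun x => mulOp V u x + ((-((hbar ^ 2 / 2 : ℝ) : ℂ)) • d + (c : ℂ) • u : L2) x from rfl,
    hwin.windowTransform_add hh (Lp.memLp _) (Lp.memLp _),
    windowTransform_congr_ae (Lp.coeFn_add _ _)]
  rw [show (⇑((-((hbar ^ 2 / 2 : ℝ) : ℂ)) • d) + ⇑((c : ℂ) • u)) =
    fun x => ((-((hbar ^ 2 / 2 : ℝ) : ℂ)) • d : L2) x + ((c : ℂ) • u : L2) x from rfl,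
    hwin.windowTransform_add hh (Lp.memLp _) (Lp.memLp _),
    windowTransform_congr_ae (Lp.coeFn_smul _ _), windowTransform_congr_ae (Lp.coeFn_smul _ _)]
  have e4 : windowTransform hbar (coherentWindow hbar) ((-((hbar ^ 2 / 2 : ℝ) : ℂ)) • ⇑d) (q, p) =
      (-((hbar ^ 2 / 2 : ℝ) : ℂ)) * windowTransform hbar (coherentWindow hbar) d (q, p) :=
    windowTransform_const_mul _ _ _
  have e5 : windowTransform hbar (coherentWindow hbar) ((c : ℂ) • ⇑u) (q, p) =
      (c : ℂ) * windowTransform hbar (coherentWindow hbar) u (q, p) :=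
    windowTransform_const_mul _ _ _
  rw [e4, e5]
  simp only [windowTransform, hamiltonian, ← hs]
  rw [mul_left_comm _ s, key]
  simp_rw [mul_left_comm _ s]
  rw [← Finset.mul_sum]
  push_cast
  ring

end Intertwining

/-! ### The intertwining defect of the resolvents -/

section IntertwiningNorm

theorem norm_mulLp_apply_le_self {X : Type*} [MeasurableSpace X] {μ : Measure X} {g : X → ℝ}
    (hg : MemLp (fun x => (g x : ℂ)) ⊤ μ) (h : ∀ x, |g x| ≤ 1) (u : Lp ℂ 2 μ) :
    ‖mulLp hg u‖ ≤ ‖u‖ := by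
  have h1 : ‖mulLp hg‖ ≤ 1 := norm_mulLp_le hg zero_le_one (ae_of_all _ fun x => by
    rw [Complex.norm_real]; exact h x)
  simpa using (mulLp hg).le_of_opNorm_le h1 u

/-- The classical resolvent `(h + C + 1)⁻¹` at an energy below the range of `h`. -/
noncomputable def phaseResolvent (V : R3 → ℝ) (C : ℝ) (z : R3 × R3) : ℝ :=
  (hamiltonian V z + (C + 1))⁻¹

variable {V : R3 → ℝ} {C : ℝ}

theorem sq_div_two_add_one_le (hVC : ∀ x, |V x| ≤ C) (z : R3 × R3) :
    ‖z.2‖ ^ 2 / 2 + 1 ≤ hamiltonian V z + (C + 1) := by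
  have := (abs_le.1 (hVC z.1)).1
  rw [hamiltonian]
  linarith

theorem hamiltonian_add_pos (hVC : ∀ x, |V x| ≤ C) (z : R3 × R3) :
    0 < hamiltonian V z + (C + 1) :=
  lt_of_lt_of_le (by positivity) (sq_div_two_add_one_le hVC z)

theorem phaseResolvent_pos (hVC : ∀ x, |V x| ≤ C) (z : R3 × R3) : 0 < phaseResolvent V C z :=
  inv_pos.2 (hamiltonian_add_pos hVC z)

theorem phaseResolvent_le_one (hVC : ∀ x, |V x| ≤ C) (z : R3 × R3) : phaseResolvent V C z ≤ 1 :=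
  inv_le_one_of_one_le₀ (le_trans (by nlinarith [sq_nonneg ‖z.2‖]) (sq_div_two_add_one_le hVC z))

theorem measurable_hamiltonian (hV : Measurable V) : Measurable (hamiltonian V) := by
  unfold hamiltonian
  have h1 : Measurable fun z : R3 × R3 => V z.1 := hV.comp measurable_fst
  fun_prop

theorem measurable_phaseResolvent (hV : Measurable V) (C : ℝ) :
    Measurable (phaseResolvent V C) :=
  ((measurable_hamiltonian hV).add_const _).inv

theorem memLp_phaseResolvent (hV : Measurable V) (hVC : ∀ x, |V x| ≤ C) :
    MemLp (fun z => (phaseResolvent V C z : ℂ)) ⊤ (volume : Measure (R3 × R3)) :=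
  memLp_top_ofReal (measurable_phaseResolvent hV C).aestronglyMeasurable fun z => by
    rw [abs_of_pos (phaseResolvent_pos hVC z)]
    exact phaseResolvent_le_one hVC z

/-- The classical resolvent absorbs the unbounded momentum factor of the intertwining defect. -/
theorem abs_phaseResolvent_mul_le_one (hVC : ∀ x, |V x| ≤ C) (j : Fin 3) (z : R3 × R3) :
    |phaseResolvent V C z * z.2 j| ≤ 1 := by
  rw [abs_mul, abs_of_pos (phaseResolvent_pos hVC z), phaseResolvent,
    inv_mul_le_iff₀ (hamiltonian_add_pos hVC z), mul_one]
  have h1 : |z.2 j| ≤ ‖z.2‖ := PiLp.norm_apply_le z.2 j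
  have h2 := sq_div_two_add_one_le hVC z
  nlinarith [sq_nonneg (‖z.2‖ - 1)]

theorem memLp_phaseResolvent_mul (hV : Measurable V) (hVC : ∀ x, |V x| ≤ C) (j : Fin 3) :
    MemLp (fun z => ((phaseResolvent V C z * z.2 j : ℝ) : ℂ)) ⊤ (volume : Measure (R3 × R3)) := by
  refine memLp_top_ofReal (Measurable.aestronglyMeasurable ?_)
    (abs_phaseResolvent_mul_le_one hVC j)
  have h1 := measurable_phaseResolvent hV C
  fun_prop

/-- Division of a three term expansion `Wy = g⁻¹ Wx + u - i ∑ pⱼ vⱼ` by its leading coefficient. -/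
theorem norm_mulLp_sub_le {X : Type*} [MeasurableSpace X] {μ : Measure X} {g : X → ℝ}
    {p : Fin 3 → X → ℝ} (hg : MemLp (fun x => (g x : ℂ)) ⊤ μ) (hg1 : ∀ x, |g x| ≤ 1)
    (hg0 : ∀ x, g x ≠ 0)
    (hp : ∀ j, MemLp (fun x => ((g x * p j x : ℝ) : ℂ)) ⊤ μ) (hp1 : ∀ j x, |g x * p j x| ≤ 1)
    {Wy Wx u : Lp ℂ 2 μ} {v : Fin 3 → Lp ℂ 2 μ}
    (h : ∀ᵐ x ∂μ, Wy x = ((g x)⁻¹ : ℝ) * Wx x + u x - Complex.I * ∑ j, (p j x : ℂ) * v j x) :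
    ‖mulLp hg Wy - Wx‖ ≤ ‖u‖ + (‖v 0‖ + ‖v 1‖ + ‖v 2‖) := by
  have key : mulLp hg Wy - Wx = mulLp hg u -
      Complex.I • (mulLp (hp 0) (v 0) + mulLp (hp 1) (v 1) + mulLp (hp 2) (v 2)) := by
    refine Lp.ext ?_
    filter_upwards [Lp.coeFn_sub (mulLp hg Wy) Wx,
      Lp.coeFn_sub (mulLp hg u)
        (Complex.I • (mulLp (hp 0) (v 0) + mulLp (hp 1) (v 1) + mulLp (hp 2) (v 2))),
      Lp.coeFn_smul Complex.I (mulLp (hp 0) (v 0) + mulLp (hp 1) (v 1) + mulLp (hp 2) (v 2)),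
      Lp.coeFn_add (mulLp (hp 0) (v 0) + mulLp (hp 1) (v 1)) (mulLp (hp 2) (v 2)),
      Lp.coeFn_add (mulLp (hp 0) (v 0)) (mulLp (hp 1) (v 1)),
      mulLp_apply_ae hg Wy, mulLp_apply_ae hg u, mulLp_apply_ae (hp 0) (v 0),
      mulLp_apply_ae (hp 1) (v 1), mulLp_apply_ae (hp 2) (v 2), h]
      with x h1 h2 h3 h4 h5 h6 h7 h8 h9 h10 h11
    rw [h1, h2, Pi.sub_apply, Pi.sub_apply, h3, Pi.smul_apply, h4, Pi.add_apply, h5, Pi.add_apply,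
      h6, h7, h8, h9, h10, h11, smul_eq_mul, Fin.sum_univ_three]
    have hgx : (g x : ℂ) * (((g x)⁻¹ : ℝ) : ℂ) = 1 := by
      rw [← Complex.ofReal_mul, mul_inv_cancel₀ (hg0 x), Complex.ofReal_one]
    rw [mul_sub, mul_add, ← mul_assoc (g x : ℂ), hgx]
    push_cast
    ring
  rw [key]
  refine (norm_sub_le _ _).trans ?_
  rw [norm_smul, Complex.norm_I, one_mul]
  exact add_le_add (norm_mulLp_apply_le_self hg hg1 u) (norm_add₃_le.trans
    (add_le_add_three (norm_mulLp_apply_le_self (hp 0) (hp1 0) _)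
      (norm_mulLp_apply_le_self (hp 1) (hp1 1) _) (norm_mulLp_apply_le_self (hp 2) (hp1 2) _)))

theorem exists_toLp_windowTransform {hbar : ℝ} (hh : 0 < hbar) {k : R3 → R3 → ℂ}
    (hkm : Measurable (Function.uncurry k)) {a : ℝ}
    (ha : 0 ≤ a) (hk : ∀ q x, ‖k q x‖ ≤ a * (1 + ‖x - q‖ ^ 2 / hbar)) (ψ : L2) :
    ∃ u : PhaseL2,
      (u =ᵐ[volume] windowTransform hbar (fun q x => coherentWindow hbar q x * k q x) ψ) ∧
        ‖u‖ ≤ 8 * a * ‖ψ‖ :=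
  ⟨_, ((isWindow_coherentWindow_mul hh hkm ha hk).memLp_windowTransform hh ψ).coeFn_toLp,
    norm_toLp_windowTransform_le hh hkm ha hk ψ⟩

/-- The intertwining defect on the domain of the Schrödinger operator. -/
theorem norm_mulLp_coherentTransform_sub_le {hbar : ℝ} (hh : 0 < hbar) (hVm : Measurable V)
    (hC : 0 ≤ C) (hVC : ∀ x, |V x| ≤ C) (hV : ∀ x y, |V x - V y| ≤ C * ‖x - y‖ ^ (1 / 5 : ℝ))
    (ψ : (schrodinger hbar V).domain) {y x : L2} (hx : (ψ : L2) = x)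
    (hy : schrodinger hbar V ψ - (-((C + 1 : ℝ) : ℂ)) • (ψ : L2) = y) :
    ‖mulLp (memLp_phaseResolvent hVm hVC) (coherentTransform hh y) - coherentTransform hh x‖ ≤
      (8 * (C * hbar ^ (1 / 10 : ℝ) + 2 * hbar) + 24 * Real.sqrt hbar) * ‖x‖ := by
  obtain ⟨u, hu, hun⟩ := exists_toLp_windowTransform hh (measurable_potentialDefect hbar hVm)
    (by positivity) (norm_potentialDefect_le hh hC hV) x
  choose v hv hvn using fun j => exists_toLp_windowTransform hh (measurable_coordDefect j)
    (Real.sqrt_nonneg hbar) (norm_coordDefect_le hh j) x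
  have h := norm_mulLp_sub_le (memLp_phaseResolvent hVm hVC)
    (fun z => by rw [abs_of_pos (phaseResolvent_pos hVC z)]; exact phaseResolvent_le_one hVC z)
    (fun z => (phaseResolvent_pos hVC z).ne') (memLp_phaseResolvent_mul hVm hVC)
    (abs_phaseResolvent_mul_le_one hVC) (Wy := coherentTransform hh y)
    (Wx := coherentTransform hh x) (u := u) (v := v) (by
      have hW := windowTransform_schrodinger hh hVm hC hVC hV (C + 1) ψ
      rw [hy, hx] at hW
      filter_upwards [coherentTransform_ae hh y, coherentTransform_ae hh x, hu, hv 0, hv 1, hv 2]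
        with z h1 h2 h3 h4 h5 h6
      rw [h1, h2, h3, hW z, Fin.sum_univ_three, Fin.sum_univ_three, h4, h5, h6, phaseResolvent,
        inv_inv])
  have h0 := hvn 0
  have h1 := hvn 1
  have h2 := hvn 2
  linarith

/-- The resolvents of the classical and the quantum Hamiltonian are intertwined by the coherent
state transform up to a small error. -/
theorem norm_intertwining_le {hbar : ℝ} (hh : 0 < hbar) (hVm : Measurable V) (hC : 0 ≤ C)
    (hVC : ∀ x, |V x| ≤ C) (hV : ∀ x y, |V x - V y| ≤ C * ‖x - y‖ ^ (1 / 5 : ℝ))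
    {A : L2 →L[ℂ] L2} (hA : IsResolvent (schrodinger hbar V) (-((C + 1 : ℝ) : ℂ)) A)
    (hA1 : ∀ y, ‖A y‖ ≤ ‖y‖) :
    ‖mulLp (memLp_phaseResolvent hVm hVC) ∘L coherentTransform hh - coherentTransform hh ∘L A‖ ≤
      8 * (C * hbar ^ (1 / 10 : ℝ) + 2 * hbar) + 24 * Real.sqrt hbar := by
  refine ContinuousLinearMap.opNorm_le_bound _ (by positivity) fun y => ?_
  obtain ⟨ψ, hx, hy⟩ := hA.2 y
  refine (norm_mulLp_coherentTransform_sub_le hh hVm hC hVC hV ψ hx hy).trans ?_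
  gcongr
  exact hA1 y

end IntertwiningNorm

/-! ### Töplitz operators as compressions -/

section Toplitz

theorem IsToplitz.unique {hbar : ℝ} {f : R3 × R3 → ℝ} {A B : L2 →L[ℂ] L2}
    (hA : IsToplitz hbar f A) (hB : IsToplitz hbar f B) : A = B := by
  ext1 ψ
  refine ext_inner_left ℂ fun χ => ?_
  rw [(hA χ ψ).2, (hB χ ψ).2]

theorem IsToplitz.toplitz_eq {hbar : ℝ} {f : R3 × R3 → ℝ} {A : L2 →L[ℂ] L2}
    (hA : IsToplitz hbar f A) : toplitz hbar f = A := by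
  have h : ∃ A, IsToplitz hbar f A := ⟨A, hA⟩
  rw [toplitz, dif_pos h]
  exact h.choose_spec.unique hA

/-- Töplitz quantization is the compression of a multiplication operator on the phase space by the
coherent state transform. -/
theorem isToplitz_compression {hbar : ℝ} (hh : 0 < hbar) {f : R3 × R3 → ℝ}
    (hf : MemLp (fun z => (f z : ℂ)) ⊤ (volume : Measure (R3 × R3))) :
    IsToplitz hbar f ((coherentTransform hh).adjoint ∘L mulLp hf ∘L coherentTransform hh) := by
  intro χ ψ
  have hpos : 0 < (2 * Real.pi * hbar) ^ 3 := by positivity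
  have hne : ((((2 * Real.pi * hbar) ^ 3 : ℝ)) : ℂ) ≠ 0 := by exact_mod_cast hpos.ne'
  have hs : ((Real.sqrt ((2 * Real.pi * hbar) ^ 3) : ℝ) : ℂ) *
      ((Real.sqrt ((2 * Real.pi * hbar) ^ 3) : ℝ) : ℂ) = (((2 * Real.pi * hbar) ^ 3 : ℝ) : ℂ) := by
    rw [← Complex.ofReal_mul, Real.mul_self_sqrt hpos.le]
  have hae : toplitzIntegrand hbar f χ ψ =ᵐ[volume] fun z =>
      (((2 * Real.pi * hbar) ^ 3 : ℝ) : ℂ) *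
        inner ℂ (coherentTransform hh χ z) (mulLp hf (coherentTransform hh ψ) z) := by
    filter_upwards [coherentTransform_ae hh χ, coherentTransform_ae hh ψ,
      mulLp_apply_ae hf (coherentTransform hh ψ)] with z h1 h2 h3
    rw [h3, h2, h1, toplitzIntegrand, coherentCoeff_eq hh, coherentCoeff_eq hh, map_mul,
      Complex.conj_ofReal, ← hs, RCLike.inner_apply]
    ring
  refine ⟨((L2.integrable_inner (𝕜 := ℂ) _ _).const_mul _).congr hae.symm, ?_⟩
  rw [integral_congr_ae hae, integral_const_mul, ← mul_assoc, Complex.ofReal_inv,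
    inv_mul_cancel₀ hne, one_mul]
  change inner ℂ χ ((coherentTransform hh).adjoint (mulLp hf (coherentTransform hh ψ))) = _
  rw [ContinuousLinearMap.adjoint_inner_right, L2.inner_def]

end Toplitz

/-! ### The algebra of symbols -/

section SymbolAlgebra

variable {X : Type*} [MeasurableSpace X] {μ : Measure X}

theorem memLp_symbol {g : X → Icc (0 : ℝ) 1} (hg : Measurable g) (F : C(Icc (0 : ℝ) 1, ℝ)) :
    MemLp (fun x => (F (g x) : ℂ)) ⊤ μ :=
  memLp_top_ofReal (F.continuous.measurable.comp hg).aestronglyMeasurable (C := ‖F‖)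
    fun x => F.norm_coe_le_norm (g x)

/-- The representation of `C([0, 1])` on `L²(μ)` by the multiplication operators `F ∘ g`. -/
noncomputable def symbolHom {g : X → Icc (0 : ℝ) 1} (hg : Measurable g) :
    C(Icc (0 : ℝ) 1, ℝ) →ₐ[ℝ] (Lp ℂ 2 μ →L[ℂ] Lp ℂ 2 μ) :=
  AlgHom.ofLinearMap
    { toFun := fun F => mulLp (μ := μ) (memLp_symbol hg F)
      map_add' := fun F G => by
        ext1 u
        change mulLp (memLp_symbol hg (F + G)) u =
          mulLp (memLp_symbol hg F) u + mulLp (memLp_symbol hg G) u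
        refine Lp.ext ?_
        filter_upwards [mulLp_apply_ae (memLp_symbol hg (F + G)) u,
          mulLp_apply_ae (memLp_symbol hg F) u, mulLp_apply_ae (memLp_symbol hg G) u,
          Lp.coeFn_add (mulLp (memLp_symbol hg F) u) (mulLp (memLp_symbol hg G) u)]
          with x h1 h2 h3 h4
        rw [h1, h4, Pi.add_apply, h2, h3, ContinuousMap.add_apply]
        push_cast
        ring
      map_smul' := fun c F => by
        ext1 u
        change mulLp (memLp_symbol hg (c • F)) u = c • mulLp (memLp_symbol hg F) u
        refine Lp.ext ?_
        filter_upwards [mulLp_apply_ae (memLp_symbol hg (c • F)) u,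
          mulLp_apply_ae (memLp_symbol hg F) u,
          Lp.coeFn_smul c (mulLp (memLp_symbol hg F) u)] with x h1 h2 h3
        rw [h1, h3, Pi.smul_apply, h2, ContinuousMap.smul_apply,
          smul_eq_mul, Complex.real_smul]
        push_cast
        ring }
    (by
      ext1 u
      refine Lp.ext ?_
      filter_upwards [mulLp_apply_ae (memLp_symbol hg 1) u] with x h1
      change mulLp _ u x = u x
      rw [h1]
      simp)
    (fun F G => by
      ext1 u
      refine Lp.ext ?_
      change mulLp (memLp_symbol hg (F * G)) u =ᵐ[μ]
        mulLp (memLp_symbol hg F) (mulLp (memLp_symbol hg G) u)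
      filter_upwards [mulLp_apply_ae (memLp_symbol hg (F * G)) u,
        mulLp_apply_ae (memLp_symbol hg F) (mulLp (memLp_symbol hg G) u),
        mulLp_apply_ae (memLp_symbol hg G) u] with x h1 h2 h3
      rw [h1, h2, h3, ContinuousMap.mul_apply]
      push_cast
      ring)

theorem norm_symbolHom_le {g : X → Icc (0 : ℝ) 1} (hg : Measurable g) (F : C(Icc (0 : ℝ) 1, ℝ)) :
    ‖symbolHom (μ := μ) hg F‖ ≤ ‖F‖ :=
  norm_mulLp_le _ (norm_nonneg F) (ae_of_all _ fun x => by
    rw [Complex.norm_real]; exact F.norm_coe_le_norm (g x))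

end SymbolAlgebra

/-! ### Asymptotically intertwined representations -/

section Approximation

variable {H : Type*} [NormedAddCommGroup H] [InnerProductSpace ℂ H]

variable {K : Type*} [NormedAddCommGroup K] [NormedSpace ℂ K] {ι : Type*} {l : Filter ι}

/-- Two families of representations of `C([0, 1])` that are asymptotically intertwined on the
coordinate function are asymptotically intertwined on every function: the functions with this
property form a closed subalgebra. -/
theorem tendsto_norm_intertwining
    (W : ι → H →L[ℂ] K) (hW : ∀ i, ‖W i‖ ≤ 1)
    (M : ι → C(Icc (0 : ℝ) 1, ℝ) →ₐ[ℝ] (K →L[ℂ] K)) (hM : ∀ i F, ‖M i F‖ ≤ ‖F‖)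
    (Φ : ι → C(Icc (0 : ℝ) 1, ℝ) →ₐ[ℝ] (H →L[ℂ] H)) (hΦ : ∀ i F, ‖Φ i F‖ ≤ ‖F‖)
    (hid : Tendsto (fun i => ‖M i (.restrict _ (.id ℝ)) ∘L W i -
      W i ∘L Φ i (.restrict _ (.id ℝ))‖) l (𝓝 0)) (F : C(Icc (0 : ℝ) 1, ℝ)) :
    Tendsto (fun i => ‖M i F ∘L W i - W i ∘L Φ i F‖) l (𝓝 0) := by
  induction F using ContinuousMap.induction_on_of_compact with
  | const r =>
    have h : ∀ i, M i (.const _ r) ∘L W i - W i ∘L Φ i (.const _ r) = 0 := fun i => by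
      have e : (ContinuousMap.const (Icc (0 : ℝ) 1) r) =
          algebraMap ℝ (C(Icc (0 : ℝ) 1, ℝ)) r := by ext; rfl
      rw [e, AlgHom.commutes, AlgHom.commutes]
      ext x
      simp [Algebra.algebraMap_eq_smul_one]
    simp_rw [h, norm_zero]
    exact tendsto_const_nhds
  | id => exact hid
  | star_id =>
    rw [show star (ContinuousMap.restrict (Icc (0 : ℝ) 1) (.id ℝ)) =
      ContinuousMap.restrict (Icc (0 : ℝ) 1) (.id ℝ) from by ext; simp]
    exact hid
  | add F G hF hG =>
    refine squeeze_zero (fun _ => norm_nonneg _) (fun i => ?_) (by simpa using hF.add hG)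
    rw [map_add, map_add, ContinuousLinearMap.add_comp, ContinuousLinearMap.comp_add,
      add_sub_add_comm]
    exact norm_add_le _ _
  | mul F G hF hG =>
    refine squeeze_zero (fun _ => norm_nonneg _) (fun i => ?_)
      (by simpa using (hG.const_mul ‖F‖).add (hF.mul_const ‖G‖))
    have e : M i (F * G) ∘L W i - W i ∘L Φ i (F * G) =
        M i F ∘L (M i G ∘L W i - W i ∘L Φ i G) + (M i F ∘L W i - W i ∘L Φ i F) ∘L Φ i G := by
      rw [map_mul, map_mul]
      ext x
      simp
    rw [e]
    refine (norm_add_le _ _).trans (add_le_add ?_ ?_)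
    · exact (ContinuousLinearMap.opNorm_comp_le _ _).trans
        (mul_le_mul_of_nonneg_right (hM i F) (norm_nonneg _))
    · exact (ContinuousLinearMap.opNorm_comp_le _ _).trans
        (mul_le_mul_of_nonneg_left (hΦ i G) (norm_nonneg _))
  | frequently F h =>
    rw [Metric.tendsto_nhds]
    intro ε hε
    obtain ⟨G, hG, hGF⟩ := (h.and_eventually (Metric.ball_mem_nhds F (ε := ε / 3)
      (by positivity))).exists
    rw [dist_eq_norm] at hGF
    filter_upwards [(Metric.tendsto_nhds.1 hG) (ε / 3) (by positivity)] with i hi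
    rw [dist_zero_right, norm_norm] at hi ⊢
    have e : M i F ∘L W i - W i ∘L Φ i F =
        (M i G ∘L W i - W i ∘L Φ i G) - (M i (G - F) ∘L W i - W i ∘L Φ i (G - F)) := by
      rw [map_sub, map_sub, ContinuousLinearMap.sub_comp, ContinuousLinearMap.comp_sub]
      abel
    have h1 : ‖M i (G - F) ∘L W i‖ ≤ ‖G - F‖ :=
      (ContinuousLinearMap.opNorm_comp_le _ _).trans
        ((mul_le_mul (hM i _) (hW i) (norm_nonneg _) (norm_nonneg _)).trans_eq (mul_one _))
    have h2 : ‖W i ∘L Φ i (G - F)‖ ≤ ‖G - F‖ :=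
      (ContinuousLinearMap.opNorm_comp_le _ _).trans
        ((mul_le_mul (hW i) (hΦ i _) (norm_nonneg _) zero_le_one).trans_eq (one_mul _))
    rw [e]
    refine (norm_sub_le _ _).trans_lt ?_
    have h3 := norm_sub_le (M i (G - F) ∘L W i) (W i ∘L Φ i (G - F))
    linarith

end Approximation

/-! ### The resolution of the identity -/

section Isometry

/-- The resolution of the identity for coherent states. -/
theorem adjoint_comp_coherentTransform {hbar : ℝ} (hh : 0 < hbar) :
    (coherentTransform hh).adjoint ∘L coherentTransform hh = 1 := by
  refine (ContinuousLinearMap.norm_map_iff_adjoint_comp_self _).1 fun ψ => ?_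
  change ‖((isWindow_coherentWindow hh).memLp_windowTransform hh ψ).toLp _‖ = ‖ψ‖
  rw [Lp.norm_toLp, (isWindow_coherentWindow hh).eLpNorm_windowTransform_eq hh
    (measurable_coe_L2 ψ) (Lp.memLp ψ) (lintegral_coherentWindow hh), Lp.norm_def]

end Isometry

/-! ### Bounds from the Hölder norm -/

section HolderBounds

theorem abs_le_of_c0HolderNorm_le {r : ℝ≥0} {V : R3 → ℝ} {K : ℝ≥0∞} (hK : K < ⊤)
    (hV : c0HolderNorm r V ≤ K) (x : R3) : |V x| ≤ K.toReal := by
  have h : ‖V x‖ₑ ≤ K := (le_iSup (fun x => ‖V x‖ₑ) x).trans (le_self_add.trans hV)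
  have h2 := ENNReal.toReal_mono hK.ne h
  rwa [toReal_enorm] at h2

theorem holderWith_of_c0HolderNorm_le {r : ℝ≥0} {V : R3 → ℝ} {K : ℝ≥0∞} (hK : K < ⊤)
    (hV : c0HolderNorm r V ≤ K) : HolderWith K.toNNReal r V := by
  have h : eHolderNorm r V ≤ K := le_add_self.trans hV
  have hm : MemHolder r V := eHolderNorm_lt_top.1 (h.trans_lt hK)
  have h2 : nnHolderNorm r V ≤ K.toNNReal := by
    rw [← ENNReal.coe_le_coe, hm.coe_nnHolderNorm_eq_eHolderNorm, ENNReal.coe_toNNReal hK.ne]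
    exact h
  intro x y
  refine (hm.holderWith x y).trans ?_
  gcongr

theorem abs_sub_le_of_c0HolderNorm_le {r : ℝ≥0} {V : R3 → ℝ} {K : ℝ≥0∞} (hK : K < ⊤)
    (hV : c0HolderNorm r V ≤ K) (x y : R3) :
    |V x - V y| ≤ K.toReal * ‖x - y‖ ^ (r : ℝ) := by
  have h := (holderWith_of_c0HolderNorm_le hK hV).dist_le x y
  rwa [Real.dist_eq, dist_eq_norm] at h

end HolderBounds

/-! ### Uniform convergence of the symbols -/

section UniformConvergence

/-- A continuous function that vanishes on the negative half-line is uniformly continuous on every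
half-line bounded above. -/
theorem uniformContinuousOn_Iic {α : ℝ → ℝ} (hα : Continuous α) (h0 : ∀ t ≤ 0, α t = 0)
    {K : ℝ} (hK : 0 ≤ K) : UniformContinuousOn α (Iic K) := by
  have h1 : UniformContinuous (IccExtend hK ((Icc 0 K).domRestrict α)) :=
    (CompactSpace.uniformContinuous_of_continuous hα.continuousOn.domRestrict).comp
      (LipschitzWith.projIcc hK).uniformContinuous
  -- On `(-∞, K]` the function is the constant extension of its restriction to `[0, K]`.
  refine (h1.uniformContinuousOn (s := Iic K)).congr fun t ht => ?_
  rcases le_total t 0 with h | h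
  · rw [IccExtend_of_le_left _ _ h, h0 t h]
    exact h0 0 le_rfl
  · rw [IccExtend_of_mem _ _ ⟨h, ht⟩]
    rfl

/-- A function `f` on the line that vanishes near `+∞`, read in the coordinate `s = (t + c)⁻¹`. -/
noncomputable def resolventSymbol (c : ℝ) {f : ℝ → ℝ} (hf : Continuous f) {t₀ : ℝ}
    (h0 : ∀ t, t₀ ≤ t → f t = 0) : C(Icc (0 : ℝ) 1, ℝ) :=
  ⟨_, (continuousOn_shiftedResolventCoord (c := c) hf h0).domRestrict⟩

theorem resolventSymbol_apply (c : ℝ) {f : ℝ → ℝ} (hf : Continuous f) {t₀ : ℝ}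
    (h0 : ∀ t, t₀ ≤ t → f t = 0) (s : Icc (0 : ℝ) 1) :
    resolventSymbol c hf h0 s = shiftedResolventCoord c f s := rfl

theorem continuous_cutoff {α : ℝ → ℝ} (hα : Continuous α) (m : ℝ) :
    Continuous fun t => α (-m - t) :=
  hα.comp (continuous_const.sub continuous_id)

theorem cutoff_eq_zero {α : ℝ → ℝ} (h0 : ∀ t ≤ 0, α t = 0) (m t : ℝ) (ht : -m ≤ t) :
    α (-m - t) = 0 := h0 _ (by linarith)

/-- The symbols of `α(-m - t)` depend continuously on `m` in the uniform norm. -/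
theorem tendsto_norm_resolventSymbol_sub {α : ℝ → ℝ} (hα : Continuous α)
    (h0 : ∀ t ≤ 0, α t = 0) (c m₀ : ℝ) :
    Tendsto (fun m => ‖resolventSymbol c (continuous_cutoff hα m) (cutoff_eq_zero h0 m) -
      resolventSymbol c (continuous_cutoff hα m₀) (cutoff_eq_zero h0 m₀)‖) (𝓝 m₀) (𝓝 0) := by
  rw [Metric.tendsto_nhds]
  intro ε hε
  -- For `s ∈ (0, 1]` and `|m - m₀| < 1`, the argument `-m - (s⁻¹ - c)` is at most `|c| + |m₀| + 1`.
  have hK : 0 ≤ |c| + |m₀| + 1 := by positivity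
  obtain ⟨δ, hδ, h⟩ := Metric.uniformContinuousOn_iff.1 (uniformContinuousOn_Iic hα h0 hK)
    (ε / 2) (by positivity)
  filter_upwards [Metric.ball_mem_nhds m₀ (lt_min hδ zero_lt_one)] with m hm
  rw [dist_zero_right, norm_norm]
  refine ((ContinuousMap.norm_le _ (by positivity : 0 ≤ ε / 2)).2 fun s => ?_).trans_lt
    (half_lt_self hε)
  rw [Metric.mem_ball, Real.dist_eq, lt_min_iff] at hm
  rw [ContinuousMap.sub_apply, resolventSymbol_apply, resolventSymbol_apply,
    shiftedResolventCoord, shiftedResolventCoord]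
  split_ifs with hs
  · rw [sub_zero, norm_zero]; positivity
  · have hs0 : 0 < (s : ℝ)⁻¹ := inv_pos.2 (lt_of_le_of_ne s.2.1 (Ne.symm hs))
    have hm1 := abs_lt.1 hm.2
    have hc := le_abs_self c
    have hm0 := neg_abs_le m₀
    rw [← dist_eq_norm]
    refine (h _ ?_ _ ?_ ?_).le
    · rw [mem_Iic]; linarith
    · rw [mem_Iic]; linarith
    · rw [Real.dist_eq, abs_sub_comm]
      rw [show -m₀ - ((s : ℝ)⁻¹ - c) - (-m - ((s : ℝ)⁻¹ - c)) = m - m₀ by ring]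
      exact hm.1

end UniformConvergence

/-! ### Functional calculus on the unit interval -/

section IntervalCalculus

variable {H : Type*} [NormedAddCommGroup H] [InnerProductSpace ℂ H] [CompleteSpace H]
  {A : H →L[ℂ] H}

/-- The continuous functional calculus of a self-adjoint operator with spectrum in `[0, 1]`, as a
representation of `C([0, 1])`. -/
noncomputable def intervalCalculus (hsa : IsSelfAdjoint A) (hs : spectrum ℝ A ⊆ Icc 0 1) :
    C(Icc (0 : ℝ) 1, ℝ) →ₐ[ℝ] (H →L[ℂ] H) :=
  (cfcHomSuperset hsa hs).toAlgHom

theorem intervalCalculus_id (hsa : IsSelfAdjoint A) (hs : spectrum ℝ A ⊆ Icc 0 1) :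
    intervalCalculus hsa hs (.restrict _ (.id ℝ)) = A :=
  cfcHomSuperset_id hsa hs

theorem norm_intervalCalculus_le (hsa : IsSelfAdjoint A) (hs : spectrum ℝ A ⊆ Icc 0 1)
    (F : C(Icc (0 : ℝ) 1, ℝ)) : ‖intervalCalculus hsa hs F‖ ≤ ‖F‖ := by
  refine (norm_cfcHom (𝕜 := ℝ) A _ hsa).trans_le ?_
  refine (ContinuousMap.norm_le _ (norm_nonneg F)).2 fun x => ?_
  exact F.norm_coe_le_norm _

theorem IsResolvent.functionalCalculus_eq_intervalCalculus {T : H →ₗ.[ℂ] H} {c : ℝ}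
    (hA : IsResolvent T (-(c : ℂ)) A) (hsa : IsSelfAdjoint A) (hs : spectrum ℝ A ⊆ Icc 0 1)
    {f : ℝ → ℝ} (hf : Continuous f) {t₀ : ℝ} (h0 : ∀ t, t₀ ≤ t → f t = 0) :
    HasFunctionalCalculus f T ∧
      Semiclassical.functionalCalculus f T = intervalCalculus hsa hs (resolventSymbol c hf h0) := by
  obtain ⟨h1, h2⟩ := hA.functionalCalculus hsa hs hf h0
  refine ⟨h1, h2.trans ?_⟩
  rw [cfc_apply _ A hsa ((continuousOn_shiftedResolventCoord hf h0).mono hs)]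
  rfl

end IntervalCalculus

/-! ### Compressions of representations by an isometry -/

section Compression

variable {H : Type*} [NormedAddCommGroup H] [InnerProductSpace ℂ H] [CompleteSpace H]
variable {K : Type*} [NormedAddCommGroup K] [InnerProductSpace ℂ K] [CompleteSpace K]

/-- A representation `Φ` on `H` is compared with the compression of a representation `M` on `K` by
an isometry `W`: one has `W† M(G) W - Φ(G) = W† (M(G) W - W Φ(G))`, and replacing `G` by `F` costs at
most `‖F - G‖` in each of the two terms. -/
theorem norm_compression_sub_le (W : H →L[ℂ] K) (hW : ‖W‖ ≤ 1) (hWW : W.adjoint ∘L W = 1)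
    (M : C(Icc (0 : ℝ) 1, ℝ) →ₐ[ℝ] (K →L[ℂ] K)) (hM : ∀ F, ‖M F‖ ≤ ‖F‖)
    (Φ : C(Icc (0 : ℝ) 1, ℝ) →ₐ[ℝ] (H →L[ℂ] H)) (hΦ : ∀ F, ‖Φ F‖ ≤ ‖F‖)
    (F G : C(Icc (0 : ℝ) 1, ℝ)) :
    ‖W.adjoint ∘L M F ∘L W - Φ F‖ ≤ ‖M G ∘L W - W ∘L Φ G‖ + 2 * ‖F - G‖ := by
  have hWa : ‖W.adjoint‖ ≤ 1 := by rwa [LinearIsometryEquiv.norm_map]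
  have e : W.adjoint ∘L M F ∘L W - Φ F =
      W.adjoint ∘L (M G ∘L W - W ∘L Φ G) + (W.adjoint ∘L M (F - G) ∘L W - Φ (F - G)) := by
    have h1 : W.adjoint ∘L (W ∘L Φ G) = Φ G := by
      rw [← ContinuousLinearMap.comp_assoc, hWW]
      exact one_mul (Φ G)
    rw [map_sub, map_sub, ContinuousLinearMap.comp_sub, h1, ContinuousLinearMap.sub_comp,
      ContinuousLinearMap.comp_sub]
    abel
  rw [e, two_mul]
  refine (norm_add_le _ _).trans (add_le_add ?_ ((norm_sub_le _ _).trans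
    (add_le_add ?_ (hΦ _))))
  · exact (ContinuousLinearMap.opNorm_comp_le _ _).trans
      (mul_le_of_le_one_left (norm_nonneg _) hWa)
  · refine (ContinuousLinearMap.opNorm_comp_le _ _).trans
      ((mul_le_of_le_one_left (norm_nonneg _) hWa).trans ?_)
    exact (ContinuousLinearMap.opNorm_comp_le _ _).trans
      ((mul_le_of_le_one_right (norm_nonneg _) hW).trans (hM _))

end Compression

/-! ### Comparison of the two quantizations -/

section Comparison

variable {V : R3 → ℝ} {C hbar : ℝ}

/-- The classical resolvent as a map to the interval `[0, 1]`. -/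
noncomputable def phaseResolventIcc (hVC : ∀ x, |V x| ≤ C) (z : R3 × R3) : Icc (0 : ℝ) 1 :=
  ⟨phaseResolvent V C z, (phaseResolvent_pos hVC z).le, phaseResolvent_le_one hVC z⟩

theorem measurable_phaseResolventIcc (hVm : Measurable V) (hVC : ∀ x, |V x| ≤ C) :
    Measurable (phaseResolventIcc hVC) :=
  (measurable_phaseResolvent hVm C).subtype_mk

theorem resolventSymbol_phaseResolventIcc (hVC : ∀ x, |V x| ≤ C) {f : ℝ → ℝ} (hf : Continuous f)
    {t₀ : ℝ} (h0 : ∀ t, t₀ ≤ t → f t = 0) (z : R3 × R3) :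
    resolventSymbol (C + 1) hf h0 (phaseResolventIcc hVC z) = f (hamiltonian V z) := by
  have e : (phaseResolventIcc hVC z : ℝ) = (hamiltonian V z + (C + 1))⁻¹ := rfl
  rw [resolventSymbol_apply, shiftedResolventCoord, e,
    if_neg (inv_pos.2 (hamiltonian_add_pos hVC z)).ne', inv_inv, add_sub_cancel_right]

/-- The Töplitz quantization of `f(h)` is the compression of the multiplication operator `F ∘ g`,
where `g` is the classical resolvent and `F` is `f` in the resolvent coordinate. -/
theorem isToplitz_comp_hamiltonian (hh : 0 < hbar) (hVm : Measurable V) (hVC : ∀ x, |V x| ≤ C)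
    {f : ℝ → ℝ} (hf : Continuous f) {t₀ : ℝ} (h0 : ∀ t, t₀ ≤ t → f t = 0) :
    IsToplitz hbar (fun z => f (hamiltonian V z)) ((coherentTransform hh).adjoint ∘L
      symbolHom (measurable_phaseResolventIcc hVm hVC) (resolventSymbol (C + 1) hf h0) ∘L
        coherentTransform hh) := by
  have e : (fun z => f (hamiltonian V z)) =
      fun z => resolventSymbol (C + 1) hf h0 (phaseResolventIcc hVC z) :=
    funext fun z => (resolventSymbol_phaseResolventIcc hVC hf h0 z).symm
  rw [e]
  exact isToplitz_compression hh
    (memLp_symbol (measurable_phaseResolventIcc hVm hVC) (resolventSymbol (C + 1) hf h0))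

variable {A : L2 →L[ℂ] L2}

theorem norm_toplitz_sub_functionalCalculus_le (hh : 0 < hbar) (hVm : Measurable V)
    (hVC : ∀ x, |V x| ≤ C) (hA : IsResolvent (schrodinger hbar V) (-((C + 1 : ℝ) : ℂ)) A)
    (hsa : IsSelfAdjoint A) (hs : spectrum ℝ A ⊆ Icc 0 1)
    {f : ℝ → ℝ} (hf : Continuous f) {t₀ : ℝ} (h0 : ∀ t, t₀ ≤ t → f t = 0)
    (G : C(Icc (0 : ℝ) 1, ℝ)) :
    ‖toplitz hbar (fun z => f (hamiltonian V z)) - functionalCalculus f (schrodinger hbar V)‖ ≤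
      ‖symbolHom (measurable_phaseResolventIcc hVm hVC) G ∘L coherentTransform hh -
        coherentTransform hh ∘L intervalCalculus hsa hs G‖ +
      2 * ‖resolventSymbol (C + 1) hf h0 - G‖ := by
  rw [(isToplitz_comp_hamiltonian hh hVm hVC hf h0).toplitz_eq,
    (hA.functionalCalculus_eq_intervalCalculus hsa hs hf h0).2]
  exact norm_compression_sub_le (coherentTransform hh) (norm_coherentTransform_le hh)
    (adjoint_comp_coherentTransform hh) _ (norm_symbolHom_le _) _
    (norm_intervalCalculus_le hsa hs) _ G

end Comparison

/-! ### The semiclassical limit -/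

section Limit

theorem tendsto_intertwining_bound (C : ℝ) :
    Tendsto (fun hbar : ℝ => 8 * (C * hbar ^ (1 / 10 : ℝ) + 2 * hbar) + 24 * Real.sqrt hbar)
      (𝓝 0) (𝓝 0) := by
  have h : Continuous fun hbar : ℝ =>
      8 * (C * hbar ^ (1 / 10 : ℝ) + 2 * hbar) + 24 * Real.sqrt hbar := by
    have h1 : Continuous fun hbar : ℝ => hbar ^ (1 / 10 : ℝ) :=
      Real.continuous_rpow_const (by norm_num)
    fun_prop
  have h2 := h.tendsto 0
  rwa [Real.zero_rpow (by norm_num), Real.sqrt_zero, mul_zero, mul_zero, add_zero, mul_zero,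
    mul_zero, add_zero] at h2

end Limit

end Semiclassical

theorem mainTheorem2 (α : ℝ → ℝ) (hα_cont : Continuous α) (hα_nonneg : ∀ t, 0 ≤ α t)
    (hα_zero : ∀ t ≤ 0, α t = 0)
    (μ : ℝ) (hμ_pos : 0 < μ) (μh : ℝ → ℝ) (hμh : Tendsto μh (𝓝[>] 0) (𝓝 μ))
    (V : ℝ → R3 → ℝ) (hV : (⨆ hbar ∈ Ioc (0 : ℝ) 1, c0HolderNorm (1 / 5) (V hbar)) < ⊤) :
    (∀ hbar ∈ Ioc (0 : ℝ) 1,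
      IsToplitz hbar (fun z => α (-μh hbar - (‖z.2‖ ^ 2 / 2 + V hbar z.1)))
        (toplitz hbar (fun z => α (-μh hbar - (‖z.2‖ ^ 2 / 2 + V hbar z.1)))) ∧
      HasFunctionalCalculus (fun t => α (-μh hbar - t)) (schrodinger hbar (V hbar))) ∧
    Tendsto
      (fun hbar : ℝ =>
        ‖toplitz hbar (fun z => α (-μh hbar - (‖z.2‖ ^ 2 / 2 + V hbar z.1))) -
          functionalCalculus (fun t => α (-μh hbar - t)) (schrodinger hbar (V hbar))‖)
      (𝓝[>] 0) (𝓝 0) := by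
  set K := ⨆ hbar ∈ Ioc (0 : ℝ) 1, c0HolderNorm (1 / 5) (V hbar) with hK
  set C := K.toReal with hC
  have hC0 : 0 ≤ C := ENNReal.toReal_nonneg
  have hVK : ∀ i : Ioc (0 : ℝ) 1, c0HolderNorm (1 / 5) (V i) ≤ K := fun i =>
    le_iSup₂ (f := fun hbar (_ : hbar ∈ Ioc (0 : ℝ) 1) => c0HolderNorm (1 / 5) (V hbar)) i.1 i.2
  have hVC : ∀ (i : Ioc (0 : ℝ) 1) x, |V i x| ≤ C := fun i =>
    abs_le_of_c0HolderNorm_le hV (hVK i)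
  have hVH : ∀ (i : Ioc (0 : ℝ) 1) x y, |V i x - V i y| ≤ C * ‖x - y‖ ^ (1 / 5 : ℝ) :=
    fun i x y => by simpa using abs_sub_le_of_c0HolderNorm_le hV (hVK i) x y
  have hVm : ∀ i : Ioc (0 : ℝ) 1, Measurable (V i) := fun i =>
    ((holderWith_of_c0HolderNorm_le hV (hVK i)).continuous (by norm_num)).measurable
  choose A hA hsa hpos using fun i : Ioc (0 : ℝ) 1 =>
    exists_isResolvent_schrodinger i.2.1 hC0 (hVm i).aestronglyMeasurable (hVC i)
  have hs := fun i => spectrum_subset_Icc_of_sq_le_re_inner (hsa i) (hpos i)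
  have hf := fun m => continuous_cutoff hα_cont m
  have hf0 := fun m => cutoff_eq_zero hα_zero m
  refine ⟨fun hbar hh => ?_, ?_⟩
  · have hT := isToplitz_comp_hamiltonian hh.1 (hVm ⟨hbar, hh⟩) (hVC ⟨hbar, hh⟩)
      (hf (μh hbar)) (hf0 (μh hbar))
    have hT' := hT.toplitz_eq
    simp only [hamiltonian] at hT hT'
    rw [hT']
    exact ⟨hT, ((hA ⟨hbar, hh⟩).functionalCalculus_eq_intervalCalculus (hsa _) (hs _)
      (hf (μh hbar)) (hf0 (μh hbar))).1⟩
  -- The limit is taken over the subtype `(0, 1]`, on which the resolvents `A i` are defined.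
  · set l : Filter (Ioc (0 : ℝ) 1) := comap Subtype.val (𝓝[>] 0) with hl
    have hrange : range (Subtype.val : Ioc (0 : ℝ) 1 → ℝ) ∈ 𝓝[>] (0 : ℝ) := by
      rw [Subtype.range_coe]
      exact Ioc_mem_nhdsGT zero_lt_one
    rw [← tendsto_comap'_iff hrange, ← hl]
    have hl0 : Tendsto (Subtype.val : Ioc (0 : ℝ) 1 → ℝ) l (𝓝[>] 0) := tendsto_comap
    have hdef := tendsto_norm_intertwining (l := l)
      (fun i : Ioc (0 : ℝ) 1 => coherentTransform i.2.1)
      (fun i => norm_coherentTransform_le i.2.1)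
      (fun i => symbolHom (measurable_phaseResolventIcc (hVm i) (hVC i)))
      (fun i F => norm_symbolHom_le _ F)
      (fun i => intervalCalculus (hsa i) (hs i))
      (fun i F => norm_intervalCalculus_le (hsa i) (hs i) F)
      (squeeze_zero (fun _ => norm_nonneg _) (fun i => by
        have h := norm_intertwining_le i.2.1 (hVm i) hC0 (hVC i) (hVH i) (hA i)
          (norm_apply_le_of_sq_le_re_inner (hpos i))
        rw [intervalCalculus_id]
        exact h)
        ((tendsto_intertwining_bound C).comp (hl0.mono_right nhdsWithin_le_nhds)))
      (resolventSymbol (C + 1) (hf μ) (hf0 μ))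
    have hsym := (tendsto_norm_resolventSymbol_sub hα_cont hα_zero (C + 1) μ).comp
      (hμh.comp hl0)
    refine squeeze_zero (fun _ => norm_nonneg _) (fun i => ?_)
      (by simpa using hdef.add (hsym.const_mul 2))
    exact norm_toplitz_sub_functionalCalculus_le i.2.1 (hVm i) (hVC i) (hA i) (hsa i) (hs i)
      (hf (μh i)) (hf0 (μh i)) _
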